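/- For a bounded domain (open set) $M\subset\mathbb{R}^2$, let $\mathcal{A}(M)$ be the family of all non-empty open sets $\Omega\subset M$ with piecewise smooth boundary; here this means that $\partial\Omega$ has finite length and that there is a finite set $F$ such that near each point of $\partial\Omega\setminus F$ the set $\partial\Omega$ is an embedded $C^r$ curve (the zero set of a $C^r$ function without critical points), where $r$ is any fixed order of smoothness with $1\le r\le\infty$ or $r=\omega$ (real-analytic). Let $|\cdot|$ denote length (one-dimensional Hausdorff measure). For $\Omega\in\mathcal{A}(M)$ put $$\eta^\partial(\Omega)=\frac{|\partial\Omega\cap M|}{|\partial\Omega\cap\partial M|}\in[0,\infty],$$ with $\eta^\partial(\Omega)=\infty$ if $|\partial\Omega\cap\partial M|=0$. For an integer $k\ge 1$, the $k$-th Escobar constant of $M$ is $$I_k(M)=\inf_{(\Omega_1,\dots,\Omega_k)}\ \max_{1\le j\le k}\eta^\partial(\Omega_j),$$ where the infimum is over all $k$-tuples of mutually disjoint members of $\mathcal{A}(M)$. Theorem (Disks). Let $\mathbb{D}\subset\mathbb{R}^2$ be the open unit disk centered at the origin. For every integer $k\ge1$ (and every choice of $r$ as above), $$I_k(\mathbb{D})=\frac{\sin(\pi/k)}{\pi/k}.$$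 -/

import Mathlib

open MeasureTheory
open scoped ENNReal

noncomputable section

namespace Escobar

/-- The Euclidean plane. Lengths of subsets are measured by the one-dimensional Hausdorff measure
`μH[1]`, which gives a rectifiable curve its usual length. -/
abbrev Plane : Type := EuclideanSpace ℝ (Fin 2)

/-- `Ω` has piecewise `C^r` boundary (for `1 ≤ r`; the value `r = ∞` means piecewise smooth):
the boundary has finite length and, away from finitely many points (the corners), it is locally
an embedded `C^r` curve, i.e. the zero set of a `C^r` function without critical points. -/
def HasPiecewiseSmoothBoundary (r : WithTop ℕ∞) (Ω : Set Plane) : Prop :=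
  μH[1] (frontier Ω) < ∞ ∧
  ∃ F : Set Plane, F.Finite ∧
    ∀ p ∈ frontier Ω \ F, ∃ U : Set Plane, IsOpen U ∧ p ∈ U ∧
      ∃ φ : Plane → ℝ, ContDiffOn ℝ r φ U ∧ (∀ q ∈ U, fderiv ℝ φ q ≠ 0) ∧
        frontier Ω ∩ U = {q ∈ U | φ q = 0}

/-- The family of non-empty open subsets of `M` with piecewise `C^r` boundary. -/
def domains (r : WithTop ℕ∞) (M : Set Plane) : Set (Set Plane) :=
  {Ω | Ω ⊆ M ∧ IsOpen Ω ∧ Ω.Nonempty ∧ HasPiecewiseSmoothBoundary r Ω}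

/-- The family of `k`-tuples of mutually disjoint members of `domains r M`. -/
def tuples (r : WithTop ℕ∞) (M : Set Plane) (k : ℕ) : Set (Fin k → Set Plane) :=
  {Ω | (∀ j, Ω j ∈ domains r M) ∧ Pairwise fun i j => Disjoint (Ω i) (Ω j)}

/-- The interior boundary of `Ω` in the open set `M`. -/
def interiorBoundary (M Ω : Set Plane) : Set Plane := frontier Ω ∩ M

/-- The exterior boundary of `Ω` in `M`. -/
def exteriorBoundary (M Ω : Set Plane) : Set Plane := frontier Ω ∩ frontier M

open Classical in
/-- The isoperimetric ratio: length of the interior boundary over length of the exterior boundary,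
with the convention that it is infinite if there is no exterior boundary (of positive length). -/
def ratio (M Ω : Set Plane) : ℝ≥0∞ :=
  if μH[1] (exteriorBoundary M Ω) = 0 then ∞
  else μH[1] (interiorBoundary M Ω) / μH[1] (exteriorBoundary M Ω)

/-- The `k`-th Escobar constant of the planar domain `M`. -/
def escobarConstant (r : WithTop ℕ∞) (M : Set Plane) (k : ℕ) : ℝ≥0∞ :=
  ⨅ Ω ∈ tuples r M k, ⨆ j, ratio M (Ω j)

end Escobar

end

noncomputable section

open MeasureTheory Set Filter Topology
open scoped ENNReal NNReal

namespace Escobar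

/-! For the upper bound, circular segments of half-angle `π/k` around `k` equally spaced directions
are disjoint, and each has a chord of length at most `2 sin(π/k)` and an arc of length at least
`2π/k`.

The lower bound rests on `chord_le_interiorBoundary`: exterior boundary of length `E` forces
interior boundary of length at least `2 sin(E/2)`. Exterior lengths of disjoint domains add up to at
most `2π`, so some domain has `E ≤ 2π/k`, and `sin x / x` decreases on `(0, π]`.

The inequality is circular symmetrization without the symmetrized set. Let `α(s)` be the angular
measure of `Ω` on the circle of radius `s`, and `h(s) = s sin(α(s)/2)`, so formally `2 dh = 2
sin(α/2) ds + s cos(α/2) dα`. If `0 < α < 2π`, the circle meets the frontier at least twice.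
Directions gained or lost between two circles are projections of frontier points. Hence the frontier
in a thin annulus has total radial variation at least `2 ds` and total angular variation about `s
|dα|` or more; Cauchy-Schwarz against the unit vector `(sin(α/2), |cos(α/2)|)` bounds `2 dh` by its
length. `annulus_estimate` proves this for any unit vector `(a, b)`, and `height_increment` applies
it to finite increments, so `α` need not be differentiable. Summing from radius near `0`, where `h`
is small, gives `two_mul_height_le`; as `s → 1`, `tendsto_trace` identifies the limit of `α` with
`E`. -/

/-! ### Arc length on the unit circle. -/

/-- The point of the unit circle with polar angle `θ`. -/
def cir (θ : ℝ) : Plane := !₂[Real.cos θ, Real.sin θ]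

@[simp] lemma cir_zero (θ : ℝ) : cir θ 0 = Real.cos θ := rfl
@[simp] lemma cir_one (θ : ℝ) : cir θ 1 = Real.sin θ := rfl

lemma inner_eq (x y : Plane) : inner ℝ x y = x 0 * y 0 + x 1 * y 1 := by
  simp [PiLp.inner_apply, Fin.sum_univ_two, mul_comm]

lemma norm_sq_eq (x : Plane) : ‖x‖ ^ 2 = x 0 ^ 2 + x 1 ^ 2 := by
  rw [← real_inner_self_eq_norm_sq, inner_eq]; ring

lemma norm_cir (θ : ℝ) : ‖cir θ‖ = 1 := by
  have h := norm_sq_eq (cir θ)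
  simp only [cir_zero, cir_one, Real.cos_sq_add_sin_sq] at h
  exact (pow_eq_one_iff_of_nonneg (norm_nonneg _) two_ne_zero).1 h

lemma dist_cir (a b : ℝ) : dist (cir a) (cir b) = 2 * |Real.sin ((a - b) / 2)| := by
  have h : dist (cir a) (cir b) ^ 2 = (2 * |Real.sin ((a - b) / 2)|) ^ 2 := by
    rw [dist_eq_norm, norm_sq_eq, mul_pow, sq_abs, Real.sin_sq_eq_half_sub,
      mul_div_cancel₀ _ two_ne_zero, Real.cos_sub]
    simp only [PiLp.sub_apply, cir_zero, cir_one]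
    nlinarith [Real.cos_sq_add_sin_sq a, Real.cos_sq_add_sin_sq b]
  exact (pow_left_inj₀ dist_nonneg (by positivity) two_ne_zero).1 h

lemma lipschitz_cir : LipschitzWith 1 cir := by
  refine LipschitzWith.of_dist_le_mul fun a b => ?_
  rw [dist_cir, Real.dist_eq]
  have := Real.abs_sin_le_abs (x := (a - b) / 2)
  rw [abs_div, abs_two] at this
  simp only [NNReal.coe_one, one_mul]
  linarith

lemma continuous_cir : Continuous cir := lipschitz_cir.continuous

lemma injOn_cir (a : ℝ) : InjOn cir (Ioc a (a + 2 * Real.pi)) := by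
  intro x hx y hy h
  have h' : dist (cir x) (cir y) = 0 := by rw [h, dist_self]
  rw [dist_cir] at h'
  have h'' : Real.sin ((x - y) / 2) = 0 := by simpa using h'
  rw [Real.sin_eq_zero_iff_of_lt_of_lt (by linarith [hx.1, hy.2]) (by linarith [hx.2, hy.1])] at h''
  linarith

lemma exists_cir_eq {x : Plane} (hx : ‖x‖ = 1) : ∃ θ ∈ Ioc (-Real.pi) Real.pi, cir θ = x := by
  have hs := norm_sq_eq x
  rw [hx] at hs
  have hz : ‖(⟨x 0, x 1⟩ : ℂ)‖ = 1 := by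
    have : ‖(⟨x 0, x 1⟩ : ℂ)‖ ^ 2 = 1 := by
      rw [Complex.sq_norm, Complex.normSq_mk]; linarith
    exact (pow_eq_one_iff_of_nonneg (norm_nonneg _) two_ne_zero).1 this
  refine ⟨_, Complex.arg_mem_Ioc ⟨x 0, x 1⟩, ?_⟩
  have h0 := Complex.norm_mul_cos_arg ⟨x 0, x 1⟩
  have h1 := Complex.norm_mul_sin_arg ⟨x 0, x 1⟩
  rw [hz, one_mul] at h0 h1
  ext i
  fin_cases i
  · exact h0
  · exact h1

/-- A `1`-Lipschitz image of a real set is not longer than the set. -/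
lemma hausdorffMeasure_image_le_volume {f : ℝ → Plane} (hf : LipschitzWith 1 f) (s : Set ℝ) :
    μH[1] (f '' s) ≤ volume s := by
  have := hf.hausdorffMeasure_image_le (d := 1) zero_le_one s
  simpa [hausdorffMeasure_real] using this

/-- A set with a `1`-Lipschitz map to the reals is at least as long as the image. -/
lemma volume_image_le {f : Plane → ℝ} (hf : LipschitzWith 1 f) (s : Set Plane) :
    volume (f '' s) ≤ μH[1] s := by
  have := hf.hausdorffMeasure_image_le (d := 1) zero_le_one s
  simpa [hausdorffMeasure_real] using this

/-- The distance to the starting point is 1-Lipschitz and, by the intermediate value theorem, takes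
all values up to the chord length. -/
lemma chord_le_arc {a b : ℝ} (hab : a ≤ b) (hb : b ≤ a + 2 * Real.pi) :
    ENNReal.ofReal (2 * Real.sin ((b - a) / 2)) ≤ μH[1] (cir '' Ioc a b) := by
  have hl : LipschitzWith 1 (fun x => dist x (cir a)) := LipschitzWith.dist_left _
  refine le_trans ?_ (volume_image_le hl _)
  have hsin : 0 ≤ Real.sin ((b - a) / 2) :=
    Real.sin_nonneg_of_nonneg_of_le_pi (by linarith) (by linarith)
  have hsub : Ioc 0 (2 * Real.sin ((b - a) / 2)) ⊆ (fun x => dist x (cir a)) '' (cir '' Ioc a b) := by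
    rw [image_image]
    have hc : ContinuousOn (fun t => dist (cir t) (cir a)) (Icc a b) :=
      (continuous_cir.dist continuous_const).continuousOn
    have := intermediate_value_Ioc hab hc
    rwa [dist_self, dist_cir, abs_of_nonneg hsin] at this
  calc _ = volume (Ioc 0 (2 * Real.sin ((b - a) / 2))) := by rw [Real.volume_Ioc, sub_zero]
    _ ≤ _ := measure_mono hsub

lemma nat_mul_chord_le_arc {a t : ℝ} (ht : 0 ≤ t) (n : ℕ) (hn : n * t ≤ 2 * Real.pi) :
    n * ENNReal.ofReal (2 * Real.sin (t / 2)) ≤ μH[1] (cir '' Ioc a (a + n * t)) := by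
  induction n with
  | zero => simp
  | succ n ih =>
    push_cast at hn ⊢
    have hnt : 0 ≤ n * t := by positivity
    have hle : n * t ≤ 2 * Real.pi := by nlinarith
    have hu : Ioc a (a + n * t) ∪ Ioc (a + n * t) (a + (n + 1) * t) = Ioc a (a + (n + 1) * t) :=
      Ioc_union_Ioc_eq_Ioc (by linarith) (by nlinarith)
    have hinj : InjOn cir (Ioc a (a + (n + 1) * t)) :=
      (injOn_cir a).mono (Ioc_subset_Ioc_right (by linarith))
    have hd : Disjoint (cir '' Ioc a (a + n * t)) (cir '' Ioc (a + n * t) (a + (n + 1) * t)) := by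
      refine disjoint_image_image fun x hx y hy h => ?_
      have := hinj (hu ▸ Or.inl hx) (hu ▸ Or.inr hy) h
      linarith [hx.2, hy.1]
    have hm : MeasurableSet (cir '' Ioc (a + n * t) (a + (n + 1) * t)) :=
      measurableSet_Ioc.image_of_continuousOn_injOn continuous_cir.continuousOn
        (hinj.mono (by rw [← hu]; exact subset_union_right))
    rw [← hu, image_union, measure_union hd hm, add_mul, one_mul]
    refine add_le_add (ih hle) ?_
    have := chord_le_arc (a := a + n * t) (b := a + (n + 1) * t) (by nlinarith) (by nlinarith)
    rwa [show a + (n + 1) * t - (a + n * t) = t by ring] at this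

/-- Arcs of the unit circle are at least as long as the angle they span. -/
lemma arc_length_ge {a b : ℝ} (hab : a ≤ b) (hb : b ≤ a + 2 * Real.pi) :
    ENNReal.ofReal (b - a) ≤ μH[1] (cir '' Ioc a b) := by
  have key : ∀ n : ℕ, ENNReal.ofReal ((n + 1 : ℕ) * (2 * Real.sin ((b - a) / (n + 1 : ℕ) / 2))) ≤
      μH[1] (cir '' Ioc a b) := by
    intro n
    have hn : ((n + 1 : ℕ) : ℝ) * ((b - a) / (n + 1 : ℕ)) = b - a := by field_simp
    have := nat_mul_chord_le_arc (a := a) (t := (b - a) / (n + 1 : ℕ))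
      (div_nonneg (by linarith) (by positivity)) (n + 1) (by rw [hn]; linarith)
    rw [hn] at this
    rw [ENNReal.ofReal_mul (by positivity), ENNReal.ofReal_natCast]
    simpa using this
  -- Lengths of inscribed polygonal lines with `n + 1` equal sides tend to the angle, by continuity
  -- of `sinc` at `0`.
  have h2 : Tendsto (fun n : ℕ => ((n + 1 : ℕ) : ℝ) * (2 * Real.sin ((b - a) / (n + 1 : ℕ) / 2)))
      atTop (𝓝 (b - a)) := by
    have h0 : Tendsto (fun n : ℕ => (b - a) / (n + 1 : ℕ) / 2) atTop (𝓝 0) := by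
      have := (tendsto_const_div_atTop_nhds_zero_nat (b - a)).comp (tendsto_add_atTop_nat 1)
      simpa using this.div_const 2
    have h1 := (Real.continuous_sinc.tendsto 0).comp h0
    rw [Real.sinc_zero] at h1
    have h3 := h1.const_mul (b - a)
    rw [mul_one] at h3
    refine h3.congr fun n => ?_
    rcases eq_or_lt_of_le hab with rfl | hlt
    · simp
    · have hne : (b - a) / ((n + 1 : ℕ) : ℝ) / 2 ≠ 0 := by
        have : 0 < b - a := by linarith
        positivity
      have hba : b - a ≠ 0 := by linarith
      simp only [Function.comp, Real.sinc_of_ne_zero hne]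
      field_simp
  exact le_of_tendsto' ((ENNReal.continuous_ofReal.tendsto _).comp h2) key

lemma sphere_eq_image_cir : Metric.sphere (0 : Plane) 1 = cir '' Ioc (-Real.pi) Real.pi := by
  ext x
  rw [mem_sphere_zero_iff_norm]
  constructor
  · exact fun h => exists_cir_eq h
  · rintro ⟨θ, -, rfl⟩
    exact norm_cir θ

lemma hausdorffMeasure_sphere :
    μH[1] (Metric.sphere (0 : Plane) 1) = ENNReal.ofReal (2 * Real.pi) := by
  rw [sphere_eq_image_cir]
  refine le_antisymm ?_ ?_
  · refine (hausdorffMeasure_image_le_volume lipschitz_cir _).trans ?_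
    rw [Real.volume_Ioc]
    exact ENNReal.ofReal_le_ofReal (by linarith)
  · have := arc_length_ge (a := -Real.pi) (b := Real.pi) (by linarith [Real.pi_pos]) (by linarith)
    rwa [show Real.pi - -Real.pi = 2 * Real.pi by ring] at this

/-! ### Circular segments and the upper bound. -/

/-- The circular segment of half-angle `α` with axis in the direction `θ`. -/
def circularSegment (θ α : ℝ) : Set Plane :=
  Metric.ball 0 1 ∩ {x | Real.cos α < inner ℝ (cir θ) x}

/-- The isometric parametrization of the line through the endpoints of the circular segment. -/
def chordMap (θ α t : ℝ) : Plane := Real.cos α • cir θ + t • cir (θ + Real.pi / 2)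

lemma lipschitz_chordMap (θ α : ℝ) : LipschitzWith 1 (chordMap θ α) := by
  refine LipschitzWith.of_dist_le_mul fun a b => ?_
  rw [dist_eq_norm, chordMap, chordMap, add_sub_add_left_eq_sub, ← sub_smul, norm_smul, norm_cir,
    Real.dist_eq, Real.norm_eq_abs]
  simp

lemma exists_chordMap_eq {θ α : ℝ} {x : Plane} (hx : inner ℝ (cir θ) x = Real.cos α) :
    ∃ t, chordMap θ α t = x ∧ t ^ 2 = ‖x‖ ^ 2 - Real.cos α ^ 2 := by
  rw [inner_eq, cir_zero, cir_one] at hx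
  have h1 := Real.cos_sq_add_sin_sq θ
  refine ⟨-Real.sin θ * x 0 + Real.cos θ * x 1, ?_, ?_⟩
  · ext i
    fin_cases i
    · simp only [chordMap, Fin.zero_eta, PiLp.add_apply, PiLp.smul_apply, cir_zero, smul_eq_mul,
        Real.cos_add_pi_div_two, ← hx]
      linear_combination x 0 * h1
    · simp only [chordMap, Fin.mk_one, PiLp.add_apply, PiLp.smul_apply, cir_one, smul_eq_mul,
        Real.sin_add_pi_div_two, ← hx]
      linear_combination x 1 * h1
  · rw [norm_sq_eq, ← hx]
    linear_combination (x 0 ^ 2 + x 1 ^ 2) * h1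

lemma chord_subset {θ α : ℝ} (h0 : 0 ≤ α) (hπ : α ≤ Real.pi) :
    {x : Plane | inner ℝ (cir θ) x = Real.cos α} ∩ Metric.closedBall 0 1 ⊆
      chordMap θ α '' Icc (-Real.sin α) (Real.sin α) := by
  rintro x ⟨hx, hb⟩
  obtain ⟨t, ht, ht2⟩ := exists_chordMap_eq hx
  refine ⟨t, abs_le.1 (abs_le_of_sq_le_sq ?_ (Real.sin_nonneg_of_nonneg_of_le_pi h0 hπ)), ht⟩
  rw [mem_closedBall_zero_iff] at hb
  rw [ht2, Real.sin_sq]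
  nlinarith [norm_nonneg x]

lemma corners_finite (θ α : ℝ) :
    ({x : Plane | inner ℝ (cir θ) x = Real.cos α} ∩ Metric.sphere 0 1).Finite := by
  refine Set.Finite.subset ((Set.toFinite {Real.sin α, -Real.sin α}).image (chordMap θ α)) ?_
  rintro x ⟨hx, hb⟩
  obtain ⟨t, ht, ht2⟩ := exists_chordMap_eq hx
  refine ⟨t, ?_, ht⟩
  rw [mem_sphere_zero_iff_norm] at hb
  rw [hb, one_pow, ← Real.sin_sq] at ht2
  exact sq_eq_sq_iff_eq_or_eq_neg.1 ht2

lemma continuous_inner_cir (θ : ℝ) : Continuous fun x : Plane => inner ℝ (cir θ) x := by fun_prop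

lemma isOpen_halfplane (θ c : ℝ) : IsOpen {x : Plane | c < inner ℝ (cir θ) x} :=
  isOpen_lt continuous_const (continuous_inner_cir θ)

/-- A nonzero linear functional is an open map, so taking frontiers commutes with its preimages. -/
lemma frontier_halfplane (θ c : ℝ) :
    frontier {x : Plane | c < inner ℝ (cir θ) x} = {x | inner ℝ (cir θ) x = c} := by
  have hs : Function.Surjective (innerSL ℝ (cir θ)) := fun t =>
    ⟨t • cir θ, by simp [norm_cir]⟩
  have h := ((innerSL ℝ (cir θ)).isOpenMap hs).preimage_frontier_eq_frontier_preimage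
    (innerSL ℝ (cir θ)).continuous (Ioi c)
  rw [frontier_Ioi] at h
  exact h.symm

lemma isOpen_circularSegment (θ α : ℝ) : IsOpen (circularSegment θ α) :=
  Metric.isOpen_ball.inter (isOpen_halfplane _ _)

lemma frontier_circularSegment_inter_halfplane (θ α : ℝ) :
    frontier (circularSegment θ α) ∩ {x | Real.cos α < inner ℝ (cir θ) x} =
      Metric.sphere 0 1 ∩ {x | Real.cos α < inner ℝ (cir θ) x} := by
  rw [circularSegment, frontier_inter_open_inter (isOpen_halfplane _ _),
    frontier_ball _ one_ne_zero]

lemma frontier_circularSegment_inter_ball (θ α : ℝ) :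
    frontier (circularSegment θ α) ∩ Metric.ball 0 1 =
      {x | inner ℝ (cir θ) x = Real.cos α} ∩ Metric.ball 0 1 := by
  rw [circularSegment, inter_comm (Metric.ball _ _), frontier_inter_open_inter Metric.isOpen_ball,
    frontier_halfplane]

lemma closure_circularSegment_subset (θ α : ℝ) :
    closure (circularSegment θ α) ⊆
      Metric.closedBall 0 1 ∩ {x | Real.cos α ≤ inner ℝ (cir θ) x} :=
  closure_minimal (inter_subset_inter Metric.ball_subset_closedBall fun x (h : _ < _) => (h.le : _ ≤ inner ℝ (cir θ) x))
    (Metric.isClosed_closedBall.inter (isClosed_le continuous_const (continuous_inner_cir θ)))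

lemma frontier_circularSegment_subset (θ α : ℝ) :
    frontier (circularSegment θ α) ⊆ Metric.sphere 0 1 ∪
      ({x | inner ℝ (cir θ) x = Real.cos α} ∩ Metric.closedBall 0 1) := by
  intro x hx
  obtain ⟨hb, hc⟩ := closure_circularSegment_subset θ α (frontier_subset_closure hx)
  rcases eq_or_lt_of_le (show Real.cos α ≤ _ from hc) with h | h
  · exact Or.inr ⟨h.symm, hb⟩
  · exact Or.inl ((frontier_circularSegment_inter_halfplane θ α).subset ⟨hx, h⟩).1

lemma hausdorffMeasure_chord_le {θ α : ℝ} (h0 : 0 ≤ α) (hπ : α ≤ Real.pi) :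
    μH[1] ({x : Plane | inner ℝ (cir θ) x = Real.cos α} ∩ Metric.closedBall 0 1) ≤
      ENNReal.ofReal (2 * Real.sin α) := by
  refine (measure_mono (chord_subset h0 hπ)).trans
    ((hausdorffMeasure_image_le_volume (lipschitz_chordMap θ α) _).trans ?_)
  rw [Real.volume_Icc]
  exact ENNReal.ofReal_le_ofReal (by linarith)

lemma circularSegment_mem_domains (r : WithTop ℕ∞) {θ α : ℝ} (h0 : 0 < α) (hπ : α ≤ Real.pi) :
    circularSegment θ α ∈ domains r (Metric.ball 0 1) := by
  refine ⟨inter_subset_left, isOpen_circularSegment θ α, ?_, ?_, _, corners_finite θ α, ?_⟩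
  · have hc : Real.cos α < 1 := by
      rw [← Real.cos_zero]
      exact Real.cos_lt_cos_of_nonneg_of_le_pi le_rfl hπ h0
    -- The point of the axis midway between the chord and the arc.
    refine ⟨((1 + Real.cos α) / 2) • cir θ, ?_, ?_⟩
    · rw [mem_ball_zero_iff, norm_smul, norm_cir, Real.norm_eq_abs, mul_one, abs_lt]
      constructor <;> linarith [Real.neg_one_le_cos α]
    · simp only [mem_ofPred_eq, inner_smul_right, real_inner_self_eq_norm_sq, norm_cir]
      linarith
  · refine (measure_mono (frontier_circularSegment_subset θ α)).trans_lt
      ((measure_union_le _ _).trans_lt (ENNReal.add_lt_top.2 ⟨?_, ?_⟩))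
    · rw [hausdorffMeasure_sphere]
      exact ENNReal.ofReal_lt_top
    · exact (hausdorffMeasure_chord_le h0.le hπ).trans_lt ENNReal.ofReal_lt_top
  · rintro p ⟨hp, hpF⟩
    obtain ⟨hb, hc⟩ := closure_circularSegment_subset θ α (frontier_subset_closure hp)
    rcases eq_or_lt_of_le (show Real.cos α ≤ _ from hc) with h | h
    · have hpb : p ∈ Metric.ball (0 : Plane) 1 := by
        rw [mem_closedBall_zero_iff] at hb
        rw [mem_ball_zero_iff]
        exact lt_of_le_of_ne hb fun h1 => hpF ⟨h.symm, by rwa [mem_sphere_zero_iff_norm]⟩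
      refine ⟨Metric.ball 0 1, Metric.isOpen_ball, hpb,
        fun x => innerSL ℝ (cir θ) x - Real.cos α, ?_, ?_, ?_⟩
      · exact ((innerSL ℝ (cir θ)).contDiff.sub contDiff_const).contDiffOn
      · intro q _ hq
        rw [fderiv_sub_const, ContinuousLinearMap.fderiv] at hq
        have := congrArg (fun f => f (cir θ)) hq
        simp [norm_cir] at this
      · rw [frontier_circularSegment_inter_ball, inter_comm]
        ext x
        simp [sub_eq_zero]
    -- The origin, which lies in this half-plane when `cos α < 0`, is the critical point of `‖x‖ ^ 2
    -- - 1` and must be removed.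
    · refine ⟨{x | Real.cos α < inner ℝ (cir θ) x} ∩ {0}ᶜ,
        (isOpen_halfplane _ _).inter isOpen_compl_singleton, ⟨h, ?_⟩, fun x => ‖x‖ ^ 2 - 1,
        ?_, ?_, ?_⟩
      · rintro rfl
        have := (frontier_circularSegment_inter_halfplane θ α).subset ⟨hp, h⟩
        simp at this
      · exact ((contDiff_norm_sq ℝ).sub contDiff_const).contDiffOn
      · rintro q ⟨-, hq⟩ h'
        rw [fderiv_sub_const, fderiv_norm_sq_apply] at h'
        have := congrArg (fun f => f q) h'
        simp at this
        exact hq this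
      · rw [← inter_assoc, frontier_circularSegment_inter_halfplane]
        ext x
        simp only [mem_inter_iff, mem_sphere_zero_iff_norm, mem_ofPred_eq, sub_eq_zero,
          pow_eq_one_iff_of_nonneg (norm_nonneg x) two_ne_zero]
        tauto

lemma inner_cir_cir (a b : ℝ) : inner ℝ (cir a) (cir b) = Real.cos (a - b) := by
  rw [inner_eq, Real.cos_sub]
  rfl

lemma exteriorBoundary_circularSegment_ge {θ α : ℝ} (h0 : 0 < α) (hπ : α ≤ Real.pi) :
    ENNReal.ofReal (2 * α) ≤
      μH[1] (exteriorBoundary (Metric.ball 0 1) (circularSegment θ α)) := by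
  have h := arc_length_ge (a := θ - α) (b := θ + α) (by linarith) (by linarith)
  rw [show θ + α - (θ - α) = 2 * α by ring] at h
  have := Measure.nullSingletonClass_hausdorff Plane one_pos
  -- The closed end of the half-open arc lies on the chord line, outside the open half-plane; a
  -- single point has no length.
  refine h.trans ((measure_mono (t := exteriorBoundary (Metric.ball 0 1) (circularSegment θ α) ∪
    {cir (θ + α)}) ?_).trans ((measure_union_le _ _).trans (by rw [measure_singleton, add_zero])))
  rintro _ ⟨t, ht, rfl⟩
  rcases eq_or_lt_of_le ht.2 with rfl | hlt
  · exact Or.inr rfl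
  · have hs : cir t ∈ Metric.sphere (0 : Plane) 1 := by rw [mem_sphere_zero_iff_norm, norm_cir]
    have hin : Real.cos α < inner ℝ (cir θ) (cir t) := by
      rw [inner_cir_cir, ← Real.cos_abs (θ - t)]
      refine Real.cos_lt_cos_of_nonneg_of_le_pi (abs_nonneg _) hπ (abs_lt.2 ⟨?_, ?_⟩) <;>
        linarith [ht.1]
    refine Or.inl ⟨((frontier_circularSegment_inter_halfplane θ α).superset ⟨hs, hin⟩).1, ?_⟩
    rwa [frontier_ball _ one_ne_zero]

lemma ratio_circularSegment_le {θ α : ℝ} (h0 : 0 < α) (hπ : α ≤ Real.pi) :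
    ratio (Metric.ball 0 1) (circularSegment θ α) ≤ ENNReal.ofReal (Real.sin α / α) := by
  have he := exteriorBoundary_circularSegment_ge (θ := θ) h0 hπ
  have hi : μH[1] (interiorBoundary (Metric.ball 0 1) (circularSegment θ α)) ≤
      ENNReal.ofReal (2 * Real.sin α) := by
    rw [interiorBoundary, frontier_circularSegment_inter_ball]
    exact (measure_mono (inter_subset_inter_right _ Metric.ball_subset_closedBall)).trans
      (hausdorffMeasure_chord_le h0.le hπ)
  have hpos : 0 < ENNReal.ofReal (2 * α) := ENNReal.ofReal_pos.2 (by linarith)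
  rw [ratio, if_neg (hpos.trans_le he).ne']
  calc _ ≤ ENNReal.ofReal (2 * Real.sin α) / ENNReal.ofReal (2 * α) := ENNReal.div_le_div hi he
    _ = ENNReal.ofReal (Real.sin α / α) := by
      rw [← ENNReal.ofReal_div_of_pos (by linarith), mul_div_mul_left _ _ two_ne_zero]

/-- Adding the two half-plane inequalities gives a sum above `2 cos α`. By sum-to-product this sum
is `2 cos((a - b)/2)` times a coordinate of `x`, hence at most `2 cos α` in the disk. -/
lemma disjoint_circularSegment {a b α : ℝ} (h : |Real.cos ((a - b) / 2)| ≤ Real.cos α) :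
    Disjoint (circularSegment a α) (circularSegment b α) := by
  rw [Set.disjoint_left]
  rintro x ⟨hx, ha⟩ ⟨-, hb⟩
  rw [mem_ball_zero_iff] at hx
  simp only [mem_ofPred_eq] at ha hb
  have hsum : inner ℝ (cir a) x + inner ℝ (cir b) x =
      2 * Real.cos ((a - b) / 2) * inner ℝ (cir ((a + b) / 2)) x := by
    simp only [inner_eq, cir_zero, cir_one]
    linear_combination x 0 * Real.cos_add_cos a b + x 1 * Real.sin_add_sin a b
  have hin : |inner ℝ (cir ((a + b) / 2)) x| ≤ 1 :=
    (abs_real_inner_le_norm _ _).trans (by rw [norm_cir, one_mul]; exact hx.le)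
  have := (abs_mul _ _).le.trans (mul_le_mul h hin (abs_nonneg _) ((abs_nonneg _).trans h))
  have := (abs_le.1 this).2
  nlinarith

/-- Half the difference of two of the directions is, up to sign, a multiple of `π/k` between `π/k`
and `π - π/k`. -/
lemma abs_cos_le {k : ℕ} {i j : Fin k} (hij : i ≠ j) :
    |Real.cos ((2 * Real.pi * i / k - 2 * Real.pi * j / k) / 2)| ≤ Real.cos (Real.pi / k) := by
  wlog hlt : j < i generalizing i j
  · rw [← Real.cos_neg, ← neg_div, neg_sub]
    exact this hij.symm (lt_of_le_of_ne (not_lt.1 hlt) hij)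
  have hk : (0 : ℝ) < k := by exact_mod_cast i.pos
  have hpi := Real.pi_pos
  have h1 : (j : ℝ) + 1 ≤ i := by exact_mod_cast hlt
  have h2 : (i : ℝ) + 1 ≤ k := by exact_mod_cast i.2
  have h3 : (0 : ℝ) ≤ j := by positivity
  have e : (2 * Real.pi * i / k - 2 * Real.pi * j / k) / 2 = Real.pi / k * (i - j) := by ring
  have hp : 0 < Real.pi / k := by positivity
  have hkp : Real.pi / k * k = Real.pi := by field_simp
  rw [e, abs_le]
  constructor
  · rw [← Real.cos_pi_sub]
    exact Real.cos_le_cos_of_nonneg_of_le_pi (by nlinarith) (by nlinarith) (by nlinarith)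
  · exact Real.cos_le_cos_of_nonneg_of_le_pi hp.le (by nlinarith) (by nlinarith)

theorem escobarConstant_disk_le (r : WithTop ℕ∞) {k : ℕ} (hk : 1 ≤ k) :
    escobarConstant r (Metric.ball 0 1) k ≤
      ENNReal.ofReal (Real.sin (Real.pi / k) / (Real.pi / k)) := by
  have hk' : (1 : ℝ) ≤ k := by exact_mod_cast hk
  have h0 : 0 < Real.pi / k := div_pos Real.pi_pos (by linarith)
  have hπ : Real.pi / k ≤ Real.pi := div_le_self Real.pi_pos.le hk'
  refine (iInf₂_le (fun j : Fin k => circularSegment (2 * Real.pi * j / k) (Real.pi / k)) ?_).trans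
    (iSup_le fun j => ratio_circularSegment_le h0 hπ)
  exact ⟨fun j => circularSegment_mem_domains r h0 hπ,
    fun i j hij => disjoint_circularSegment (abs_cos_le hij)⟩

/-! ### Regular boundary points on the unit circle. -/

/-- Off its frontier, an open set and the complement of its closure form an open partition. -/
lemma subset_of_isPreconnected {X : Type*} [TopologicalSpace X] {s Ω : Set X}
    (hs : IsPreconnected s) (hΩ : IsOpen Ω)
    (hd : Disjoint s (frontier Ω)) (hne : (s ∩ Ω).Nonempty) : s ⊆ Ω := by
  refine IsPreconnected.subset_left_of_subset_union hΩ isClosed_closure.isOpen_compl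
    (disjoint_compl_right.mono_left subset_closure) (fun x hx => ?_) hne hs
  by_contra h
  rw [mem_union, not_or, notMem_compl_iff] at h
  refine Set.disjoint_left.1 hd hx ?_
  rw [hΩ.frontier_eq]
  exact ⟨h.2, h.1⟩

/-- A segment that does not meet the frontier of an open set and starts in the set stays in it. -/
lemma mem_of_segment {E : Type*} [AddCommGroup E] [Module ℝ E] [TopologicalSpace E]
    [ContinuousAdd E] [ContinuousSMul ℝ E] {Ω : Set E}
    (hΩ : IsOpen Ω) {a v : E} (ha : a ∈ Ω)
    (h : ∀ t ∈ Icc (0 : ℝ) 1, a + t • v ∉ frontier Ω) : a + v ∈ Ω := by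
  have hpre : IsPreconnected ((fun t : ℝ => a + t • v) '' Icc 0 1) :=
    isPreconnected_Icc.image _ (by fun_prop)
  have hsub := subset_of_isPreconnected hpre hΩ
    (Set.disjoint_left.2 (by rintro _ ⟨t, ht, rfl⟩; exact h t ht))
    ⟨a, ⟨0, by simp, by simp⟩, ha⟩
  exact hsub ⟨1, by simp, by simp⟩

/-- If a functional is nonnegative on an open half space and nonzero, it is positive on the inner
normal. -/
lemma pos_of_nonneg_on_halfspace {p : Plane} (hp1 : ‖p‖ = 1) {f : Plane →L[ℝ] ℝ} (hf : f ≠ 0)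
    (h : ∀ v, 0 < inner ℝ p v → 0 ≤ f v) : 0 < f p := by
  have hpp : inner ℝ p p = (1 : ℝ) := by rw [real_inner_self_eq_norm_sq, hp1, one_pow]
  refine lt_of_le_of_ne (h p (by rw [hpp]; exact one_pos)) fun h0 => hf ?_
  have hv : ∀ v, 0 ≤ f v := fun v => by
    -- If `f p = 0`, shifting `v` along `p` into the half space does not change `f v`; so `f ≥ 0`
    -- everywhere and `f = 0`.
    have := h (v + (1 - inner ℝ p v) • p) (by
      rw [inner_add_right, inner_smul_right, hpp]; linarith)
    rwa [map_add, map_smul, ← h0, smul_zero, add_zero] at this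
  ext v
  have := hv (-v)
  rw [map_neg] at this
  exact le_antisymm (by simpa using this) (hv v)

lemma fderiv_nonneg_of_pos {φ : Plane → ℝ} {f : Plane →L[ℝ] ℝ} {p v : Plane}
    (hf : HasFDerivAt φ f p) (h0 : φ p = 0) (h : ∀ᶠ t : ℝ in 𝓝[>] 0, 0 < φ (p + t • v)) :
    0 ≤ f v := by
  have hline : HasDerivAt (fun t : ℝ => φ (p + t • v)) (f v) 0 := by
    have h1 : HasDerivAt (fun t : ℝ => p + t • v) v 0 := by
      simpa using ((hasDerivAt_id (0 : ℝ)).smul_const v).const_add p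
    have h2 : HasFDerivAt φ f (p + (0 : ℝ) • v) := by simpa using hf
    exact h2.comp_hasDerivAt 0 h1
  have ht := (hasDerivAt_iff_tendsto_slope.1 hline).mono_left (nhdsGT_le_nhdsNE 0)
  refine ge_of_tendsto ht ?_
  filter_upwards [h, self_mem_nhdsWithin] with t h1 h2
  rw [slope_def_field]
  simp only [zero_smul, add_zero, h0, sub_zero]
  exact (div_pos h1 h2).le

lemma exists_ball_of_hasStrictFDerivAt {φ : Plane → ℝ} {f : Plane →L[ℝ] ℝ} {p : Plane}
    (h : HasStrictFDerivAt φ f p) {ε : ℝ} (hε : 0 < ε) :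
    ∃ R > 0, ∀ y ∈ Metric.ball p R, ∀ z ∈ Metric.ball p R,
      |φ y - φ z - f (y - z)| ≤ ε * ‖y - z‖ := by
  have h1 := h.isLittleO.def hε
  rw [nhds_prod_eq] at h1
  obtain ⟨t, ht, h2⟩ := Filter.eventually_prod_self_iff'.1 h1
  obtain ⟨R, hR, hRt⟩ := Metric.mem_nhds_iff.1 ht
  exact ⟨R, hR, fun y hy z hz => h2 y (hRt hy) z (hRt hz)⟩

/-- Near a regular boundary point on the unit circle, an open subset of the disk contains the
radius. Version with a chosen sign of the defining function. -/
lemma radius_mem_of_pos {Ω : Set Plane} (hΩ : IsOpen Ω) (hsub : Ω ⊆ Metric.ball 0 1) {p : Plane}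
    (hp : p ∈ frontier Ω) (hp1 : ‖p‖ = 1) {R₀ : ℝ} (hR₀ : 0 < R₀) {φ : Plane → ℝ}
    (hφ : ContDiffAt ℝ 1 φ p) (hd : fderiv ℝ φ p ≠ 0)
    (hz : ∀ q ∈ Metric.ball p R₀, q ∈ frontier Ω ↔ φ q = 0)
    (hpos : ∀ q ∈ Metric.ball p R₀, 1 < inner ℝ p q → 0 < φ q) :
    ∀ᶠ t : ℝ in 𝓝[<] 1, t • p ∈ Ω := by
  have hpp : inner ℝ p p = (1 : ℝ) := by rw [real_inner_self_eq_norm_sq, hp1, one_pow]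
  have hφp : φ p = 0 := (hz p (Metric.mem_ball_self hR₀)).1 hp
  set f := fderiv ℝ φ p with hf
  have hst : HasStrictFDerivAt φ f p := hφ.hasStrictFDerivAt one_ne_zero
  have hfp : 0 < f p := by
    refine pos_of_nonneg_on_halfspace hp1 hd fun v hv =>
      fderiv_nonneg_of_pos hst.hasFDerivAt hφp ?_
    have hc : Tendsto (fun t : ℝ => p + t • v) (𝓝[>] 0) (𝓝 p) := by
      have : Continuous (fun t : ℝ => p + t • v) := by fun_prop
      simpa using (this.tendsto 0).mono_left nhdsWithin_le_nhds
    filter_upwards [hc (Metric.ball_mem_nhds p hR₀), self_mem_nhdsWithin] with t h1 h2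
    refine hpos _ h1 ?_
    rw [inner_add_right, inner_smul_right, hpp]
    have : 0 < t * inner ℝ p v := mul_pos h2 hv
    linarith
  -- Since `f p > 0`, strict differentiability makes `φ` strictly increasing in the direction `p`
  -- near `p`; the frontier is then a graph over the tangent line.
  obtain ⟨R, hR, hRR₀, hcont, hmono⟩ : ∃ R, 0 < R ∧ R ≤ R₀ ∧
      (∀ y ∈ Metric.ball p R, ContinuousAt φ y) ∧
      ∀ y ∈ Metric.ball p R, ∀ s : ℝ, 0 < s → y + s • p ∈ Metric.ball p R →
        φ y < φ (y + s • p) := by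
    obtain ⟨R₁, hR₁, h1⟩ := exists_ball_of_hasStrictFDerivAt hst (half_pos hfp)
    have h2 : ∀ᶠ q in 𝓝 p, ContinuousAt φ q :=
      (hφ.eventually (by simp)).mono fun q hq => hq.continuousAt
    obtain ⟨R₂, hR₂, h2⟩ := Metric.eventually_nhds_iff_ball.1 h2
    refine ⟨min R₀ (min R₁ R₂), by positivity, min_le_left _ _, fun y hy => h2 y ?_,
      fun y hy s hs hys => ?_⟩
    · exact Metric.ball_subset_ball ((min_le_right _ _).trans (min_le_right _ _)) hy
    · have hb := Metric.ball_subset_ball (x := p) ((min_le_right R₀ (min R₁ R₂)).trans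
        (min_le_left _ _))
      have h3 := (abs_le.1 (h1 _ (hb hys) _ (hb hy))).1
      rw [add_sub_cancel_left, map_smul, norm_smul, hp1, mul_one, Real.norm_of_nonneg hs.le,
        smul_eq_mul] at h3
      nlinarith [mul_pos hs hfp]
  have hnf : ∀ q ∈ Metric.ball p R, φ q ≠ 0 → q ∉ frontier Ω := fun q hq h0 hqf =>
    h0 ((hz q (Metric.ball_subset_ball hRR₀ hq)).1 hqf)
  have hline : ∀ t : ℝ, |t| < R → p + t • p ∈ Metric.ball p R := fun t ht => by
    rwa [mem_ball_iff_norm, add_sub_cancel_left, norm_smul, hp1, mul_one]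
  set m := p + (-(R / 2)) • p with hm
  have hmB : m ∈ Metric.ball p R := hline _ (by rw [abs_neg, abs_of_pos] <;> linarith)
  have hneg : ∀ t : ℝ, 0 < t → t < R → φ (p + (-t) • p) < 0 := fun t ht htR => by
    have := hmono _ (hline (-t) (by rw [abs_neg, abs_of_pos] <;> linarith)) t ht
      (by rw [neg_smul, neg_add_cancel_right]; exact Metric.mem_ball_self hR)
    rwa [neg_smul, neg_add_cancel_right, hφp, ← neg_smul] at this
  obtain ⟨ρ, hρ, hρB⟩ : ∃ ρ > 0, ∀ q ∈ Metric.ball m ρ, φ q < 0 :=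
    Metric.eventually_nhds_iff_ball.1
      ((hcont m hmB).eventually_lt_const (hneg (R / 2) (by linarith) (by linarith)))
  -- A point `q` of `Ω` near `p` is joined to `m`, on the radius at depth `R / 2`, along a path
  -- avoiding the frontier: first inwards parallel to the radius, then sideways within the ball
  -- around `m`.
  obtain ⟨q, hqΩ, hqp⟩ := Metric.mem_closure_iff.1 (frontier_subset_closure hp)
    (min ρ (R / 4)) (by positivity)
  have hqρ : ‖q - p‖ < ρ := by
    rw [← dist_eq_norm, dist_comm]; exact hqp.trans_le (min_le_left _ _)
  have hqR : ‖q - p‖ < R / 4 := by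
    rw [← dist_eq_norm, dist_comm]; exact hqp.trans_le (min_le_right _ _)
  have hqB : ∀ t : ℝ, |t| ≤ R / 2 → q + t • p ∈ Metric.ball p R := fun t ht => by
    rw [mem_ball_iff_norm, show q + t • p - p = (q - p) + t • p by abel]
    refine (norm_add_le _ _).trans_lt ?_
    rw [norm_smul, hp1, mul_one, Real.norm_eq_abs]
    linarith
  have hqB0 : q ∈ Metric.ball p R := by simpa using hqB 0 (by simp; linarith)
  have hq0 : φ q ≠ 0 := fun h0 => by
    have := (hz q (Metric.ball_subset_ball hRR₀ hqB0)).2 h0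
    rw [hΩ.frontier_eq] at this
    exact this.2 hqΩ
  have hφq : φ q < 0 := by
    refine lt_of_le_of_ne (not_lt.1 fun hlt => ?_) hq0
    -- If `φ q > 0`, moving outwards keeps `φ > 0`, so the segment stays in `Ω`; but it leaves the
    -- disk.
    have hmem : q + (R / 2) • p ∈ Ω := by
      refine mem_of_segment hΩ hqΩ fun t ht => ?_
      rw [smul_smul]
      have hB := hqB (t * (R / 2)) (by
        rw [abs_of_nonneg (mul_nonneg ht.1 (by linarith))]; nlinarith [ht.2])
      refine hnf _ hB (ne_of_gt ?_)
      rcases eq_or_lt_of_le ht.1 with rfl | h0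
      · simpa using hlt
      · exact hlt.trans (hmono q hqB0 _ (by positivity) hB)
    have h1 := hsub hmem
    rw [mem_ball_zero_iff] at h1
    have h2 := real_inner_le_norm p (q + (R / 2) • p)
    have h3 := (abs_le.1 (abs_real_inner_le_norm p (q - p))).1
    rw [hp1, one_mul] at h2 h3
    rw [inner_add_right, inner_smul_right, hpp] at h2
    rw [inner_sub_right, hpp] at h3
    linarith
  have hqm : q + (-(R / 2)) • p ∈ Ω := by
    refine mem_of_segment hΩ hqΩ fun t ht => ?_
    rw [smul_smul]
    have hB := hqB (t * (-(R / 2))) (by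
      rw [mul_neg, abs_neg, abs_of_nonneg (mul_nonneg ht.1 (by linarith))]; nlinarith [ht.2])
    refine hnf _ hB (ne_of_lt ?_)
    rcases eq_or_lt_of_le ht.1 with rfl | h0
    · simpa using hφq
    · have := hmono _ hB (t * (R / 2)) (by positivity) (by
        rw [mul_neg, neg_smul, neg_add_cancel_right]; exact hqB0)
      rw [mul_neg, neg_smul, neg_add_cancel_right] at this
      rw [mul_neg, neg_smul]
      exact this.trans hφq
  have hmΩ : m ∈ Ω := by
    have h1 := mem_of_segment (v := p - q) hΩ hqm fun t ht hfr => ?_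
    · rwa [show q + (-(R / 2)) • p + (p - q) = m by rw [hm]; abel] at h1
    have e : q + (-(R / 2)) • p + t • (p - q) - m = (1 - t) • (q - p) := by
      rw [hm]; module
    have hn : ‖(1 - t) • (q - p)‖ ≤ ‖q - p‖ := by
      rw [norm_smul, Real.norm_of_nonneg (by linarith [ht.2])]
      nlinarith [ht.1, norm_nonneg (q - p)]
    have e' : q + (-(R / 2)) • p + t • (p - q) - p = (1 - t) • (q - p) + (-(R / 2)) • p := by
      module
    refine hnf _ ?_ (hρB _ ?_).ne hfr
    · rw [mem_ball_iff_norm, e']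
      refine (norm_add_le _ _).trans_lt ?_
      rw [norm_smul (-(R / 2)), hp1, mul_one, norm_neg, Real.norm_of_nonneg (by linarith)]
      linarith
    · rw [mem_ball_iff_norm, e]
      exact hn.trans_lt hqρ
  have hlt : 1 - R / 2 < 1 := by linarith
  filter_upwards [Ico_mem_nhdsLT hlt] with t ht
  have h1 := mem_of_segment (v := (t - (1 - R / 2)) • p) hΩ hmΩ fun s hs => ?_
  · rwa [show m + (t - (1 - R / 2)) • p = t • p by rw [hm]; module] at h1
  · have hs' : 0 < R / 2 - s * (t - (1 - R / 2)) := by nlinarith [hs.1, hs.2, ht.1, ht.2]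
    have hs'' : R / 2 - s * (t - (1 - R / 2)) ≤ R / 2 := by nlinarith [hs.1, hs.2, ht.1, ht.2]
    have e : m + s • (t - (1 - R / 2)) • p = p + (-(R / 2 - s * (t - (1 - R / 2)))) • p := by
      rw [hm]; module
    rw [e]
    refine hnf _ (hline _ ?_) (hneg _ hs' (by linarith)).ne
    rw [abs_neg, abs_of_pos hs']
    linarith

/-- Near a regular boundary point on the unit circle, an open subset of the disk contains the
radius. -/
lemma radius_mem {Ω : Set Plane} (hΩ : IsOpen Ω) (hsub : Ω ⊆ Metric.ball 0 1) {p : Plane}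
    (hp : p ∈ frontier Ω) (hp1 : ‖p‖ = 1) {U : Set Plane} (hU : IsOpen U) (hpU : p ∈ U)
    {φ : Plane → ℝ} (hφ : ContDiffOn ℝ 1 φ U) (hd : fderiv ℝ φ p ≠ 0)
    (hz : frontier Ω ∩ U = {q ∈ U | φ q = 0}) :
    ∀ᶠ t : ℝ in 𝓝[<] 1, t • p ∈ Ω := by
  obtain ⟨R, hR, hRU⟩ := Metric.isOpen_iff.1 hU p hpU
  have hφp : ContDiffAt ℝ 1 φ p := hφ.contDiffAt (hU.mem_nhds hpU)
  have hz' : ∀ q ∈ Metric.ball p R, q ∈ frontier Ω ↔ φ q = 0 := fun q hq =>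
    ⟨fun h => (hz.subset ⟨h, hRU hq⟩).2, fun h => (hz.superset ⟨hRU hq, h⟩).1⟩
  -- Beyond the tangent line there are no points of the closed disk, so `φ` has no zero on this
  -- convex cap and keeps one sign.
  set W := Metric.ball p R ∩ {q | 1 < inner ℝ p q} with hW
  have hWpre : IsPreconnected W := by
    refine ((convex_ball p R).inter ?_).isPreconnected
    exact convex_halfSpace_gt (innerSL ℝ p).isLinear 1
  have hne : ∀ q ∈ W, φ q ≠ 0 := fun q hq h0 => by
    have h1 : q ∈ Metric.closedBall (0 : Plane) 1 :=
      closure_minimal (hsub.trans Metric.ball_subset_closedBall) Metric.isClosed_closedBall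
        (frontier_subset_closure ((hz' q hq.1).2 h0))
    rw [mem_closedBall_zero_iff] at h1
    have h2 := real_inner_le_norm p q
    have h3 : 1 < inner ℝ p q := hq.2
    rw [hp1, one_mul] at h2
    linarith
  have hcont : ContinuousOn φ W := hφ.continuousOn.mono (inter_subset_left.trans hRU)
  have hsign : (∀ q ∈ W, 0 < φ q) ∨ ∀ q ∈ W, φ q < 0 := by
    by_contra! h
    obtain ⟨⟨a, ha, ha0⟩, b, hb, hb0⟩ := h
    obtain ⟨c, hc, hc0⟩ := hWpre.intermediate_value ha hb hcont ⟨ha0, hb0⟩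
    exact hne c hc hc0
  rcases hsign with h | h
  · exact radius_mem_of_pos hΩ hsub hp hp1 hR hφp hd hz' fun q hq hq1 => h q ⟨hq, hq1⟩
  · refine radius_mem_of_pos (φ := fun q => -φ q) hΩ hsub hp hp1 hR hφp.neg ?_ ?_ fun q hq hq1 =>
      neg_pos.2 (h q ⟨hq, hq1⟩)
    · rwa [fderiv_fun_neg, neg_ne_zero]
    · simpa using hz'

/-! ### Radial and angular variation along a regular curve. -/

/-- The radial projection to the unit circle. -/
def radialProj (x : Plane) : Plane := ‖x‖⁻¹ • x

/-- Both sides equal `2 (‖y‖ ‖z‖ - ⟨y, z⟩)`. This is the finite form of `ρ² dθ² = ds² - dρ²`. -/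
lemma norm_radialProj_sub_sq {y z : Plane} (hy : y ≠ 0) (hz : z ≠ 0) :
    ‖y‖ * ‖z‖ * ‖radialProj y - radialProj z‖ ^ 2 = ‖y - z‖ ^ 2 - (‖y‖ - ‖z‖) ^ 2 := by
  have hy' := norm_ne_zero_iff.2 hy
  have hz' := norm_ne_zero_iff.2 hz
  rw [norm_sub_sq_real, norm_sub_sq_real, radialProj, radialProj, norm_smul, norm_smul,
    inner_smul_left, inner_smul_right]
  simp only [norm_inv, norm_norm, conj_trivial]
  field_simp
  ring

/-- In the plane, a vector almost orthogonal to the unit vector `N` is almost parallel to the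
rotated vector, so its products with a fixed vector are almost determined by its length. -/
lemma exists_abs_inner_approx {N e : Plane} (hN : ‖N‖ = 1) (he : ‖e‖ ≤ 1) :
    ∃ c : ℝ, 0 ≤ c ∧ c ≤ 1 ∧ ∀ v : Plane, |(|inner ℝ e v| - c * ‖v‖)| ≤ 2 * |inner ℝ N v| := by
  set T : Plane := !₂[-N 1, N 0] with hT
  have hT0 : T 0 = -N 1 := rfl
  have hT1 : T 1 = N 0 := rfl
  have hN2 := norm_sq_eq N
  rw [hN, one_pow] at hN2
  have hT2 : ‖T‖ = 1 := by
    have : ‖T‖ ^ 2 = 1 := by rw [norm_sq_eq, hT0, hT1]; linarith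
    exact (pow_eq_one_iff_of_nonneg (norm_nonneg _) two_ne_zero).1 this
  have hc : |inner ℝ e T| ≤ 1 := (abs_real_inner_le_norm _ _).trans (by rw [hT2, mul_one]; exact he)
  refine ⟨|inner ℝ e T|, abs_nonneg _, hc, fun v => ?_⟩
  have hdec : inner ℝ e v = inner ℝ N v * inner ℝ e N + inner ℝ T v * inner ℝ e T := by
    simp only [inner_eq, hT0, hT1]
    linear_combination (e 0 * v 0 + e 1 * v 1) * hN2
  have hv : ‖v‖ ^ 2 = |inner ℝ N v| ^ 2 + |inner ℝ T v| ^ 2 := by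
    rw [sq_abs, sq_abs, norm_sq_eq]
    simp only [inner_eq, hT0, hT1]
    linear_combination (v 0 ^ 2 + v 1 ^ 2) * hN2
  have h1 : |inner ℝ T v| ≤ ‖v‖ :=
    (abs_real_inner_le_norm _ _).trans (by rw [hT2, one_mul])
  have h2 : ‖v‖ ≤ |inner ℝ N v| + |inner ℝ T v| := by
    nlinarith [abs_nonneg (inner ℝ N v), abs_nonneg (inner ℝ T v), norm_nonneg v]
  have heN : |inner ℝ e N| ≤ 1 := (abs_real_inner_le_norm _ _).trans (by rw [hN, mul_one]; exact he)
  have h3 : |inner ℝ N v * inner ℝ e N| ≤ |inner ℝ N v| := by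
    rw [abs_mul]; exact mul_le_of_le_one_right (abs_nonneg _) heN
  have h4 : |inner ℝ T v * inner ℝ e T| = |inner ℝ T v| * |inner ℝ e T| := abs_mul _ _
  have h5 : |(|inner ℝ e v| - |inner ℝ T v * inner ℝ e T|)| ≤ |inner ℝ N v * inner ℝ e N| := by
    refine (abs_abs_sub_abs_le _ _).trans ?_
    rw [hdec, add_sub_cancel_right]
  rw [h4] at h5
  have h6 := abs_le.1 h5
  rw [abs_le]
  constructor <;> nlinarith [abs_nonneg (inner ℝ e T), abs_nonneg (inner ℝ N v)]

/-- On a small piece of a regular curve, distances to the origin change at almost constant speed. -/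
lemma exists_radial_speed {Γ : Set Plane} {x : Plane} (hx0 : x ≠ 0) {U : Set Plane}
    (hU : IsOpen U) (hxU : x ∈ U) {φ : Plane → ℝ} (hφ : ContDiffOn ℝ 1 φ U)
    (hd : fderiv ℝ φ x ≠ 0) (hz : Γ ∩ U = {q ∈ U | φ q = 0}) {ε : ℝ} (hε : 0 < ε) :
    ∃ c : ℝ, 0 ≤ c ∧ c ≤ 1 ∧ ∃ V : Set Plane, IsOpen V ∧ x ∈ V ∧ ∀ y ∈ Γ ∩ V, ∀ z ∈ Γ ∩ V,
      (c - ε) * ‖y - z‖ ≤ |‖y‖ - ‖z‖| ∧ |‖y‖ - ‖z‖| ≤ (c + ε) * ‖y - z‖ := by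
  set f := fderiv ℝ φ x with hf
  have hst : HasStrictFDerivAt φ f x :=
    (hφ.contDiffAt (hU.mem_nhds hxU)).hasStrictFDerivAt one_ne_zero
  have hst' : HasStrictFDerivAt (fun y : Plane => ‖y‖) (fderiv ℝ (fun y : Plane => ‖y‖) x) x :=
    (contDiffAt_norm ℝ hx0 (n := 1)).hasStrictFDerivAt one_ne_zero
  set n := (InnerProductSpace.toDual ℝ Plane).symm f with hn
  set e := (InnerProductSpace.toDual ℝ Plane).symm (fderiv ℝ (fun y : Plane => ‖y‖) x) with he
  have hnf : ∀ v, f v = inner ℝ n v := fun v => by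
    rw [hn, InnerProductSpace.toDual_symm_apply]
  have hef : ∀ v, fderiv ℝ (fun y : Plane => ‖y‖) x v = inner ℝ e v := fun v => by
    rw [he, InnerProductSpace.toDual_symm_apply]
  have hn0 : n ≠ 0 := by
    rw [hn, Ne, LinearIsometryEquiv.map_eq_zero_iff]; exact hd
  have hn0' := norm_pos_iff.2 hn0
  have he1 : ‖e‖ ≤ 1 := by
    rw [he, LinearIsometryEquiv.norm_map]
    simpa using norm_fderiv_le_of_lipschitz ℝ (x₀ := x) (lipschitzWith_one_norm (E := Plane))
  have hN : ‖(‖n‖⁻¹ • n)‖ = 1 := by rw [norm_smul, norm_inv, norm_norm, inv_mul_cancel₀ hn0'.ne']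
  obtain ⟨c, hc0, hc1, hc⟩ := exists_abs_inner_approx hN he1
  -- With this tolerance the normal component of a chord is at most `ε / 3` times its length. It
  -- enters doubled, and linearizing the norm costs another `ε / 3`.
  obtain ⟨R₁, hR₁, h1⟩ := exists_ball_of_hasStrictFDerivAt hst
    (show 0 < ‖n‖ * (ε / 3) by positivity)
  obtain ⟨R₂, hR₂, h2⟩ := exists_ball_of_hasStrictFDerivAt hst' (show 0 < ε / 3 by positivity)
  refine ⟨c, hc0, hc1, U ∩ (Metric.ball x R₁ ∩ Metric.ball x R₂),
    hU.inter (Metric.isOpen_ball.inter Metric.isOpen_ball),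
    ⟨hxU, Metric.mem_ball_self hR₁, Metric.mem_ball_self hR₂⟩, ?_⟩
  rintro y ⟨hyΓ, hyU, hy1, hy2⟩ z ⟨hzΓ, hzU, hz1, hz2⟩
  have hy0 : φ y = 0 := (hz.subset ⟨hyΓ, hyU⟩).2
  have hz0 : φ z = 0 := (hz.subset ⟨hzΓ, hzU⟩).2
  have h3 := h1 y hy1 z hz1
  rw [hy0, hz0, sub_self, zero_sub, abs_neg, hnf] at h3
  have h4 := h2 y hy2 z hz2
  rw [hef] at h4
  have h5 : |inner ℝ (‖n‖⁻¹ • n) (y - z)| ≤ ε / 3 * ‖y - z‖ := by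
    rw [inner_smul_left, conj_trivial, abs_mul, abs_inv, abs_norm, inv_mul_le_iff₀ hn0']
    linarith
  have h6 := abs_le.1 ((hc (y - z)).trans (mul_le_mul_of_nonneg_left h5 zero_le_two))
  have h7 := abs_le.1 ((abs_abs_sub_abs_le _ _).trans h4)
  constructor <;> nlinarith [norm_nonneg (y - z)]

/-- The geometric properties of the pieces of a boundary used in the length estimates. -/
def IsPiece (ε : ℝ) (Γ V : Set Plane) (w A B : ℝ≥0) : Prop :=
  (∀ a b : ℝ, 0 ≤ a → 0 ≤ b → a ^ 2 + b ^ 2 = 1 → a * (w * A) + b * B ≤ 1 + 4 * ε) ∧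
  1 ≤ w ∧ (InjOn norm (Γ ∩ V) ∨ w = 2) ∧ LipschitzOnWith A norm (Γ ∩ V) ∧
  ∀ s : ℝ≥0, 0 < s → LipschitzOnWith (B / s) radialProj (Γ ∩ V ∩ {y | s ≤ ‖y‖})

/-- A small piece of a regular curve: the radial projection and the distance to the origin are
Lipschitz on it, with constants that satisfy a sharp Cauchy-Schwarz bound. The weight `w` accounts
for multiplicities in the values of the distance to the origin. -/
lemma exists_piece {Γ : Set Plane} {x : Plane} (hx0 : x ≠ 0) {U : Set Plane}
    (hU : IsOpen U) (hxU : x ∈ U) {φ : Plane → ℝ} (hφ : ContDiffOn ℝ 1 φ U)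
    (hd : fderiv ℝ φ x ≠ 0) (hz : Γ ∩ U = {q ∈ U | φ q = 0}) {ε : ℝ} (hε : 0 < ε) :
    ∃ V : Set Plane, IsOpen V ∧ x ∈ V ∧ ∃ w A B, IsPiece ε Γ V w A B := by
  obtain ⟨c, hc0, hc1, V, hV, hxV, hsp⟩ := exists_radial_speed hx0 hU hxU hφ hd hz hε
  have hLip : LipschitzOnWith (NNReal.mk (c + ε) (by linarith)) norm (Γ ∩ V) :=
    LipschitzOnWith.of_dist_le_mul fun y hy z hz => by
      rw [Real.dist_eq, dist_eq_norm]
      exact (hsp y hy z hz).2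
  have hproj : ∀ B : ℝ≥0, (∀ y ∈ Γ ∩ V, ∀ z ∈ Γ ∩ V,
      ‖y - z‖ ^ 2 - (‖y‖ - ‖z‖) ^ 2 ≤ B ^ 2 * ‖y - z‖ ^ 2) → ∀ s : ℝ≥0, 0 < s →
      LipschitzOnWith (B / s) radialProj (Γ ∩ V ∩ {y | s ≤ ‖y‖}) := by
    intro B hB s hs
    refine LipschitzOnWith.of_dist_le_mul fun y hy z hz => ?_
    have hs' : (0 : ℝ) < s := hs
    have hys : (s : ℝ) ≤ ‖y‖ := hy.2
    have hzs : (s : ℝ) ≤ ‖z‖ := hz.2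
    have h := norm_radialProj_sub_sq (norm_pos_iff.1 (hs'.trans_le hys))
      (norm_pos_iff.1 (hs'.trans_le hzs))
    have h2 := hB y hy.1 z hz.1
    rw [← h] at h2
    rw [dist_eq_norm, dist_eq_norm, NNReal.coe_div, div_mul_eq_mul_div, le_div_iff₀ hs']
    refine abs_le_of_sq_le_sq' ?_ (by positivity) |>.2
    have h3 : (s : ℝ) * s ≤ ‖y‖ * ‖z‖ := mul_le_mul hys hzs hs'.le (norm_nonneg _)
    nlinarith [sq_nonneg ‖radialProj y - radialProj z‖]
  -- If `c ≤ ε`, the norm may fail to be injective on the piece, but its Lipschitz constant is at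
  -- most `2 ε`, so the weight `2` costs only `4 ε`. Otherwise the norm is injective, and
  -- Cauchy-Schwarz applies to the unit vector `(c - ε, σ)`.
  rcases le_or_gt c ε with hcε | hcε
  · refine ⟨V, hV, hxV, 2, _, 1, ?_, one_le_two, Or.inr rfl, hLip, hproj 1 ?_⟩
    · intro a b ha hb hab
      have ha1 : a ≤ 1 := by nlinarith
      have hb1 : b ≤ 1 := by nlinarith
      simp only [NNReal.coe_mk, NNReal.coe_one, NNReal.coe_ofNat]
      nlinarith
    · intro y _ z _
      rw [NNReal.coe_one]
      nlinarith [sq_nonneg (‖y‖ - ‖z‖)]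
  · have hs1 : 0 ≤ 1 - (c - ε) ^ 2 := by nlinarith
    refine ⟨V, hV, hxV, 1, _, NNReal.mk (Real.sqrt (1 - (c - ε) ^ 2)) (Real.sqrt_nonneg _), ?_, le_rfl,
      Or.inl ?_, hLip, hproj _ ?_⟩
    · intro a b ha hb hab
      have ha1 : a ≤ 1 := by nlinarith
      simp only [NNReal.coe_mk, NNReal.coe_one, one_mul]
      have h1 := Real.sq_sqrt hs1
      set σ := Real.sqrt (1 - (c - ε) ^ 2)
      nlinarith [sq_nonneg (a - (c - ε)), sq_nonneg (b - σ)]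
    · intro y hy z hz h
      have h1 := (hsp y hy z hz).1
      rw [show ‖y‖ = ‖z‖ from h, sub_self, abs_zero] at h1
      have h2 : ‖y - z‖ ≤ 0 := by
        by_contra! h3
        nlinarith [mul_pos (sub_pos.2 hcε) h3]
      exact sub_eq_zero.1 (norm_le_zero_iff.1 h2)
    · intro y hy z hz
      rw [NNReal.coe_mk, Real.sq_sqrt hs1]
      have h1 := (hsp y hy z hz).1
      have h2 : ((c - ε) * ‖y - z‖) ^ 2 ≤ (‖y‖ - ‖z‖) ^ 2 := by
        rw [← sq_abs (‖y‖ - ‖z‖)]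
        exact pow_le_pow_left₀ (mul_nonneg (by linarith) (norm_nonneg _)) h1 2
      nlinarith

/-! ### Traces on concentric circles and the annulus estimate. -/

/-- The directions in which the circle of radius `r` meets `Ω`. -/
def trace (Ω : Set Plane) (r : ℝ) : Set Plane := Metric.sphere 0 1 ∩ {p | r • p ∈ Ω}

/-- The angular measure of the part of the circle of radius `r` inside `Ω`. -/
def angle (Ω : Set Plane) (r : ℝ) : ℝ := (μH[1] (trace Ω r)).toReal

/-- The part of `Γ` in a closed annulus. -/
def annulus (Γ : Set Plane) (r₁ r₂ : ℝ) : Set Plane := Γ ∩ {x | ‖x‖ ∈ Icc r₁ r₂}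

lemma trace_ne_top (Ω : Set Plane) (r : ℝ) : μH[1] (trace Ω r) ≠ ∞ :=
  ne_top_of_le_ne_top (by rw [hausdorffMeasure_sphere]; exact ENNReal.ofReal_ne_top)
    (measure_mono inter_subset_left)

lemma isClosed_annulus {Γ : Set Plane} (hΓ : IsClosed Γ) (r₁ r₂ : ℝ) :
    IsClosed (annulus Γ r₁ r₂) :=
  hΓ.inter (isClosed_Icc.preimage continuous_norm)

lemma radialProj_smul {p : Plane} (hp : ‖p‖ = 1) {t : ℝ} (ht : 0 < t) : radialProj (t • p) = p := by
  rw [radialProj, norm_smul, hp, mul_one, Real.norm_of_nonneg ht.le, smul_smul,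
    inv_mul_cancel₀ ht.ne', one_smul]

lemma exists_frontier_on_radius {Ω : Set Plane} (hΩ : IsOpen Ω) {p : Plane} (hp : ‖p‖ = 1)
    {r₁ r₂ s t : ℝ} (h₁ : 0 < r₁) (hs : s ∈ Icc r₁ r₂) (ht : t ∈ Icc r₁ r₂)
    (hsΩ : s • p ∈ Ω) (htΩ : t • p ∉ Ω) :
    p ∈ radialProj '' annulus (frontier Ω) r₁ r₂ := by
  by_contra h
  refine htΩ ?_
  have := mem_of_segment (v := (t - s) • p) hΩ hsΩ fun u hu hf => h ?_
  · rwa [← add_smul, add_sub_cancel] at this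
  rw [smul_smul, ← add_smul] at hf
  have hm : s + u * (t - s) ∈ Icc r₁ r₂ := by
    have := (convex_Icc r₁ r₂).add_smul_sub_mem hs ht hu
    simpa using this
  have hpos : 0 < s + u * (t - s) := h₁.trans_le hm.1
  refine ⟨_, ⟨hf, ?_⟩, radialProj_smul hp hpos⟩
  rw [mem_ofPred_eq, norm_smul, hp, mul_one, Real.norm_of_nonneg hpos.le]
  exact hm

lemma trace_subset {Ω : Set Plane} (hΩ : IsOpen Ω) {r₁ r₂ s t : ℝ} (h₁ : 0 < r₁)
    (hs : s ∈ Icc r₁ r₂) (ht : t ∈ Icc r₁ r₂) :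
    trace Ω s ⊆ trace Ω t ∪ radialProj '' annulus (frontier Ω) r₁ r₂ := by
  rintro p ⟨hp, hpΩ⟩
  by_cases h : t • p ∈ Ω
  · exact Or.inl ⟨hp, h⟩
  · exact Or.inr (exists_frontier_on_radius hΩ (mem_sphere_zero_iff_norm.1 hp) h₁ hs ht hpΩ h)

/-- On a ray whose endpoints are on different sides, the segment between the two circles must cross
the frontier. -/
lemma ofReal_abs_angle_sub_le {Ω : Set Plane} (hΩ : IsOpen Ω) {r₁ r₂ : ℝ} (h₁ : 0 < r₁)
    (h₁₂ : r₁ ≤ r₂) :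
    ENNReal.ofReal |angle Ω r₂ - angle Ω r₁| ≤
      μH[1] (radialProj '' annulus (frontier Ω) r₁ r₂) := by
  have key : ∀ s ∈ Icc r₁ r₂, ∀ t ∈ Icc r₁ r₂, ENNReal.ofReal (angle Ω s - angle Ω t) ≤
      μH[1] (radialProj '' annulus (frontier Ω) r₁ r₂) := by
    intro s hs t ht
    have h := (measure_mono (trace_subset hΩ h₁ hs ht)).trans
      (measure_union_le (μ := μH[1]) _ _)
    rw [angle, angle, ENNReal.ofReal_sub _ ENNReal.toReal_nonneg,
      ENNReal.ofReal_toReal (trace_ne_top _ _), ENNReal.ofReal_toReal (trace_ne_top _ _)]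
    exact tsub_le_iff_left.2 h
  have hl : r₁ ∈ Icc r₁ r₂ := left_mem_Icc.2 h₁₂
  have hr : r₂ ∈ Icc r₁ r₂ := right_mem_Icc.2 h₁₂
  rcases abs_cases (angle Ω r₂ - angle Ω r₁) with h | h
  · rw [h.1]; exact key _ hr _ hl
  · rw [h.1, neg_sub]; exact key _ hl _ hr

lemma periodic_cir : Function.Periodic cir (2 * Real.pi) := fun θ => by
  ext i
  fin_cases i
  · exact Real.cos_add_two_pi θ
  · exact Real.sin_add_two_pi θ

lemma exists_cir_eq_Ioc (θ₀ : ℝ) {x : Plane} (hx : ‖x‖ = 1) :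
    ∃ θ ∈ Ioc θ₀ (θ₀ + 2 * Real.pi), cir θ = x := by
  obtain ⟨θ, -, rfl⟩ := exists_cir_eq hx
  have := periodic_cir.image_Ioc Real.two_pi_pos θ₀
  exact this.superset (mem_range_self θ)

/-- A circle that is neither inside nor outside `Ω` meets the frontier in at least two points. -/
lemma exists_two_frontier_points {Ω : Set Plane} (hΩ : IsOpen Ω) {r : ℝ} (hr : 0 < r)
    (h0 : 0 < angle Ω r) (h2 : angle Ω r < 2 * Real.pi) :
    ∃ y ∈ frontier Ω, ∃ z ∈ frontier Ω, y ≠ z ∧ ‖y‖ = r ∧ ‖z‖ = r := by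
  by_contra! hcon
  have hnull := Measure.nullSingletonClass_hausdorff Plane one_pos
  have hnorm : ∀ t, ‖r • cir t‖ = r := fun t => by
    rw [norm_smul, norm_cir, mul_one, Real.norm_of_nonneg hr.le]
  -- Cut the circle at its only possible frontier point. The remaining open arc is connected and
  -- misses the frontier, so it lies in `Ω` or is disjoint from it.
  obtain ⟨θ₀, hθ₀⟩ : ∃ θ₀, ∀ t, r • cir t ∈ frontier Ω → cir t = cir θ₀ := by
    by_cases h : ∃ θ₀, r • cir θ₀ ∈ frontier Ω
    · obtain ⟨θ₀, hθ₀⟩ := h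
      refine ⟨θ₀, fun t ht => ?_⟩
      by_contra hne
      exact hcon _ ht _ hθ₀ (fun he => hne (smul_right_injective _ hr.ne' he)) (hnorm _) (hnorm _)
    · push Not at h
      exact ⟨0, fun t ht => absurd ht (h t)⟩
  have hpre : IsPreconnected ((fun t => r • cir t) '' Ioo θ₀ (θ₀ + 2 * Real.pi)) :=
    isPreconnected_Ioo.image _ (continuous_cir.const_smul r).continuousOn
  have hdisj : Disjoint ((fun t => r • cir t) '' Ioo θ₀ (θ₀ + 2 * Real.pi)) (frontier Ω) := by
    rw [Set.disjoint_left]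
    rintro _ ⟨t, ht, rfl⟩ hf
    have h := hθ₀ t hf
    rw [← periodic_cir θ₀] at h
    have := injOn_cir θ₀ ⟨ht.1, ht.2.le⟩ ⟨by linarith [Real.pi_pos], le_rfl⟩ h
    exact ht.2.ne this
  have hcov : Metric.sphere (0 : Plane) 1 ⊆ cir '' Ioo θ₀ (θ₀ + 2 * Real.pi) ∪ {cir θ₀} := by
    intro x hx
    obtain ⟨θ, hθ, rfl⟩ := exists_cir_eq_Ioc θ₀ (mem_sphere_zero_iff_norm.1 hx)
    rcases eq_or_lt_of_le hθ.2 with rfl | hlt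
    · exact Or.inr (periodic_cir θ₀)
    · exact Or.inl ⟨θ, ⟨hθ.1, hlt⟩, rfl⟩
  by_cases hne : ((fun t => r • cir t) '' Ioo θ₀ (θ₀ + 2 * Real.pi) ∩ Ω).Nonempty
  · have hsub := subset_of_isPreconnected hpre hΩ hdisj hne
    have hle : μH[1] (Metric.sphere (0 : Plane) 1) ≤ μH[1] (trace Ω r) := by
      refine (measure_mono (t := trace Ω r ∪ {cir θ₀}) fun x hx => ?_).trans
        ((measure_union_le _ _).trans (by rw [measure_singleton, add_zero]))
      rcases hcov hx with ⟨t, ht, rfl⟩ | h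
      · exact Or.inl ⟨hx, hsub ⟨t, ht, rfl⟩⟩
      · exact Or.inr h
    rw [hausdorffMeasure_sphere] at hle
    have := (ENNReal.ofReal_le_iff_le_toReal (trace_ne_top _ _)).1 hle
    exact absurd h2 (not_lt.2 this)
  · have hsub : trace Ω r ⊆ {cir θ₀} := by
      rintro x ⟨hx, hxΩ⟩
      rcases hcov hx with ⟨t, ht, rfl⟩ | h
      · exact absurd ⟨r • cir t, ⟨t, ht, rfl⟩, hxΩ⟩ hne
      · exact h
    have : μH[1] (trace Ω r) = 0 := measure_mono_null hsub (measure_singleton _)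
    rw [angle, this] at h0
    simp at h0

/-- Lindelöf property; `P ∅` serves only the case of empty `T`. -/
lemma exists_nat_cover {X : Type*} [TopologicalSpace X] [SecondCountableTopology X] {T : Set X}
    {P : Set X → Prop} (h0 : P ∅) (h : ∀ x ∈ T, ∃ V, IsOpen V ∧ x ∈ V ∧ P V) :
    ∃ V : ℕ → Set X, (∀ n, IsOpen (V n)) ∧ (∀ n, P (V n)) ∧ T ⊆ ⋃ n, V n := by
  rcases T.eq_empty_or_nonempty with rfl | hT
  · exact ⟨fun _ => ∅, fun _ => isOpen_empty, fun _ => h0, empty_subset _⟩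
  choose! V hVo hxV hP using h
  obtain ⟨t, htT, htc, hcov⟩ := TopologicalSpace.countable_cover_nhdsWithin (s := T) (f := V)
    fun x hx => mem_nhdsWithin_of_mem_nhds ((hVo x hx).mem_nhds (hxV x hx))
  have htne : t.Nonempty := by
    obtain ⟨x, hx⟩ := hT
    obtain ⟨i, hi, -⟩ := mem_iUnion₂.1 (hcov hx)
    exact ⟨i, hi⟩
  obtain ⟨f, rfl⟩ := htc.exists_eq_range htne
  refine ⟨fun n => V (f n), fun n => hVo _ (htT (mem_range_self n)),
    fun n => hP _ (htT (mem_range_self n)), ?_⟩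
  rwa [biUnion_range] at hcov

/-- Sharp length estimate in an annulus: the boundary has to account for both the radial extent of
the annulus, twice, and for the change of the angular measure. -/
lemma annulus_estimate {r : WithTop ℕ∞} (hr : 1 ≤ r) {Ω : Set Plane} (hΩ : IsOpen Ω)
    (hb : HasPiecewiseSmoothBoundary r Ω) {r₁ r₂ : ℝ} (h₁ : 0 < r₁) (h₁₂ : r₁ ≤ r₂) {ε : ℝ}
    (hε : 0 < ε) {a b : ℝ} (ha : 0 ≤ a) (hb0 : 0 ≤ b) (hab : a ^ 2 + b ^ 2 = 1)
    (hZ : a = 0 ∨ ∀ s ∈ Ioo r₁ r₂, 0 < angle Ω s ∧ angle Ω s < 2 * Real.pi) :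
    2 * a * (r₂ - r₁) + b * (r₁ * |angle Ω r₂ - angle Ω r₁|) ≤
      (1 + 4 * ε) * (μH[1] (annulus (frontier Ω) r₁ r₂)).toReal := by
  obtain ⟨hfin, F, hF, hreg⟩ := hb
  have hnull := Measure.nullSingletonClass_hausdorff Plane one_pos
  set Γ := frontier Ω with hΓ
  set T := annulus Γ r₁ r₂ \ F with hT
  have hTmeas : MeasurableSet T :=
    (isClosed_annulus isClosed_frontier r₁ r₂).measurableSet.diff hF.measurableSet
  obtain ⟨V, hVo, hVP, hcov⟩ : ∃ V : ℕ → Set Plane, (∀ n, IsOpen (V n)) ∧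
      (∀ n, ∃ w A B, IsPiece ε Γ (V n) w A B) ∧ T ⊆ ⋃ n, V n := by
    refine exists_nat_cover (P := fun V => ∃ w A B, IsPiece ε Γ V w A B)
      ⟨1, 0, 0, ?_, le_rfl, by simp, by simp, by simp⟩ ?_
    · intro a b _ _ _
      simp only [NNReal.coe_zero, mul_zero, add_zero]
      positivity
    · rintro x ⟨⟨hxΓ, hx⟩, hxF⟩
      obtain ⟨U, hU, hxU, φ, hφ, hd, hz⟩ := hreg x ⟨hxΓ, hxF⟩
      have hx0 : x ≠ 0 := norm_pos_iff.1 (h₁.trans_le hx.1)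
      exact exists_piece hx0 hU hxU (hφ.of_le hr) (hd x hxU) hz hε
  choose w A B hP using hVP
  -- Disjoint pieces, so that their lengths add up to that of `T` exactly and the constant stays
  -- sharp.
  set D : ℕ → Set Plane := fun n => T ∩ disjointed V n with hD
  have hDm : ∀ n, MeasurableSet (D n) := fun n =>
    hTmeas.inter (MeasurableSet.disjointed (fun n => (hVo n).measurableSet) n)
  have hDd : Pairwise (Function.onFun Disjoint D) := fun i j hij =>
    (disjoint_disjointed V hij).mono inter_subset_right inter_subset_right
  have hDU : ⋃ n, D n = T := by
    rw [hD, ← inter_iUnion, iUnion_disjointed]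
    exact inter_eq_left.2 hcov
  have hDΓ : ∀ n, D n ⊆ Γ ∩ V n := fun n x hx => ⟨hx.1.1.1, disjointed_subset V n hx.2⟩
  have hsum : ∑' n, μH[1] (D n) = μH[1] T := by rw [← measure_iUnion hDd hDm, hDU]
  set s : ℝ≥0 := NNReal.mk r₁ h₁.le with hs
  have hs0 : 0 < s := h₁
  have hρ : ∀ n, volume (norm '' D n) ≤ A n * μH[1] (D n) := fun n => by
    have := ((hP n).2.2.2.1.mono (hDΓ n)).hausdorffMeasure_image_le (d := 1) zero_le_one
    simpa [hausdorffMeasure_real] using this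
  have hπ : ∀ n, s * μH[1] (radialProj '' D n) ≤ B n * μH[1] (D n) := fun n => by
    have h := ((hP n).2.2.2.2 s hs0 |>.mono (s := D n)
      fun x hx => ⟨hDΓ n hx, hx.1.1.2.1⟩).hausdorffMeasure_image_le (d := 1) zero_le_one
    rw [ENNReal.rpow_one] at h
    calc _ ≤ (s : ℝ≥0∞) * (((B n / s : ℝ≥0) : ℝ≥0∞) * μH[1] (D n)) := by gcongr
      _ = B n * μH[1] (D n) := by
        rw [← mul_assoc, ← ENNReal.coe_mul, mul_div_cancel₀ _ hs0.ne']
  have hang : ENNReal.ofReal (r₁ * |angle Ω r₂ - angle Ω r₁|) ≤ ∑' n, B n * μH[1] (D n) := by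
    have h1 : μH[1] (radialProj '' annulus Γ r₁ r₂) ≤ ∑' n, μH[1] (radialProj '' D n) := by
      have hsub : radialProj '' annulus Γ r₁ r₂ ⊆ (⋃ n, radialProj '' D n) ∪ radialProj '' F := by
        rw [← image_iUnion, hDU, ← image_union]
        exact image_mono (by rw [hT, sdiff_union_self]; exact subset_union_left)
      refine (measure_mono hsub).trans ((measure_union_le _ _).trans ?_)
      rw [(hF.image radialProj).measure_zero, add_zero]
      exact measure_iUnion_le _
    rw [ENNReal.ofReal_mul h₁.le]
    calc _ ≤ (s : ℝ≥0∞) * ∑' n, μH[1] (radialProj '' D n) := by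
          refine mul_le_mul' ?_ ((ofReal_abs_angle_sub_le hΩ h₁ h₁₂).trans h1)
          rw [ENNReal.ofReal_eq_coe_nnreal h₁.le]
      _ = ∑' n, s * μH[1] (radialProj '' D n) := ENNReal.tsum_mul_left.symm
      _ ≤ _ := ENNReal.tsum_le_tsum hπ
  have hrad : (∀ s ∈ Ioo r₁ r₂, 0 < angle Ω s ∧ angle Ω s < 2 * Real.pi) →
      ENNReal.ofReal (2 * (r₂ - r₁)) ≤ ∑' n, w n * (A n * μH[1] (D n)) := by
    intro hZ
    -- Measurable hulls spare a proof that the images of the pieces under the norm are measurable.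
    set H : ℕ → Set ℝ := fun n => toMeasurable volume (norm '' D n) with hH
    have hpt : ∀ t ∈ Ioo r₁ r₂ \ norm '' F,
        (2 : ℝ≥0∞) ≤ ∑' n, (H n).indicator (fun _ => (w n : ℝ≥0∞)) t := by
      rintro t ⟨ht, htF⟩
      obtain ⟨y, hy, z, hz, hyz, hyt, hzt⟩ :=
        exists_two_frontier_points hΩ (h₁.trans ht.1) (hZ t ht).1 (hZ t ht).2
      have hmem : ∀ y ∈ Γ, ‖y‖ = t → ∃ n, y ∈ D n := fun y hy hyt => by
        have hyI : ‖y‖ ∈ Icc r₁ r₂ := by rw [hyt]; exact ⟨ht.1.le, ht.2.le⟩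
        have hyT : y ∈ T := ⟨⟨hy, hyI⟩, fun hyF => htF ⟨y, hyF, hyt⟩⟩
        rw [← hDU] at hyT
        exact mem_iUnion.1 hyT
      obtain ⟨n, hn⟩ := hmem y hy hyt
      obtain ⟨m, hm⟩ := hmem z hz hzt
      have hval : ∀ n y, y ∈ D n → ‖y‖ = t → (H n).indicator (fun _ => (w n : ℝ≥0∞)) t = w n :=
        fun n y hy hyt =>
          indicator_of_mem (subset_toMeasurable volume _ (show t ∈ norm '' D n from ⟨y, hy, hyt⟩)) _
      -- Two frontier points on one circle lie in distinct pieces, each of weight at least `1`, or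
      -- in one piece where the norm is not injective, of weight `2`.
      by_cases hnm : n = m
      · subst hnm
        have hw : w n = 2 := (hP n).2.2.1.resolve_left fun hinj =>
          hyz (hinj (hDΓ n hn) (hDΓ n hm) (hyt.trans hzt.symm))
        refine le_trans ?_ (ENNReal.le_tsum n)
        rw [hval n y hn hyt, hw]
        simp
      · refine le_trans ?_ (ENNReal.sum_le_tsum {n, m})
        rw [Finset.sum_pair hnm, hval n y hn hyt, hval m z hm hzt, ← one_add_one_eq_two]
        exact add_le_add (by exact_mod_cast (hP n).2.1) (by exact_mod_cast (hP m).2.1)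
    have hmeas : MeasurableSet (Ioo r₁ r₂ \ norm '' F) :=
      measurableSet_Ioo.diff (hF.image _).measurableSet
    have hvol : volume (Ioo r₁ r₂ \ norm '' F) = ENNReal.ofReal (r₂ - r₁) := by
      rw [measure_sdiff_null ((hF.image _).measure_zero _), Real.volume_Ioo]
    calc ENNReal.ofReal (2 * (r₂ - r₁)) = ∫⁻ _ in Ioo r₁ r₂ \ norm '' F, 2 := by
          rw [setLIntegral_const, hvol, ENNReal.ofReal_mul zero_le_two, ENNReal.ofReal_ofNat]
      _ ≤ ∫⁻ t in Ioo r₁ r₂ \ norm '' F, ∑' n, (H n).indicator (fun _ => (w n : ℝ≥0∞)) t :=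
          setLIntegral_mono' hmeas hpt
      _ ≤ ∫⁻ t, ∑' n, (H n).indicator (fun _ => (w n : ℝ≥0∞)) t := setLIntegral_le_lintegral _ _
      _ = ∑' n, w n * volume (norm '' D n) := by
          rw [lintegral_tsum fun n => (measurable_const.indicator
            (measurableSet_toMeasurable _ _)).aemeasurable]
          refine tsum_congr fun n => ?_
          rw [lintegral_indicator_const (measurableSet_toMeasurable _ _), measure_toMeasurable]
      _ ≤ _ := ENNReal.tsum_le_tsum fun n => mul_le_mul_right (hρ n) _
  have htot : ENNReal.ofReal (2 * a * (r₂ - r₁) + b * (r₁ * |angle Ω r₂ - angle Ω r₁|)) ≤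
      ENNReal.ofReal (1 + 4 * ε) * μH[1] T := by
    have hrad' : ENNReal.ofReal (2 * a * (r₂ - r₁)) ≤
        ∑' n, ENNReal.ofReal a * (w n * (A n * μH[1] (D n))) := by
      rcases hZ with rfl | hZ
      · simp
      · rw [ENNReal.tsum_mul_left, mul_assoc, mul_left_comm, ENNReal.ofReal_mul ha]
        exact mul_le_mul_right (hrad hZ) _
    have hang' : ENNReal.ofReal (b * (r₁ * |angle Ω r₂ - angle Ω r₁|)) ≤
        ∑' n, ENNReal.ofReal b * (B n * μH[1] (D n)) := by
      rw [ENNReal.tsum_mul_left, ENNReal.ofReal_mul hb0]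
      exact mul_le_mul_right hang _
    calc _ ≤ ENNReal.ofReal (2 * a * (r₂ - r₁)) +
            ENNReal.ofReal (b * (r₁ * |angle Ω r₂ - angle Ω r₁|)) := ENNReal.ofReal_add_le
      _ ≤ _ := add_le_add hrad' hang'
      _ = ∑' n, ENNReal.ofReal (a * (w n * A n) + b * B n) * μH[1] (D n) := by
          rw [← ENNReal.tsum_add]
          refine tsum_congr fun n => ?_
          rw [ENNReal.ofReal_add (by positivity) (by positivity), ENNReal.ofReal_mul ha,
            ENNReal.ofReal_mul hb0, ENNReal.ofReal_mul (by positivity), ENNReal.ofReal_coe_nnreal,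
            ENNReal.ofReal_coe_nnreal, ENNReal.ofReal_coe_nnreal]
          ring
      _ ≤ ∑' n, ENNReal.ofReal (1 + 4 * ε) * μH[1] (D n) :=
          ENNReal.tsum_le_tsum fun n =>
            mul_le_mul_left (ENNReal.ofReal_le_ofReal ((hP n).1 a b ha hb0 hab)) _
      _ = _ := by rw [ENNReal.tsum_mul_left, hsum]
  have hle : μH[1] T ≤ μH[1] (annulus Γ r₁ r₂) := measure_mono sdiff_subset
  have hann : μH[1] (annulus Γ r₁ r₂) ≠ ∞ :=
    ne_top_of_le_ne_top hfin.ne (measure_mono inter_subset_left)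
  have h := htot.trans (mul_le_mul_right hle _)
  rw [ENNReal.ofReal_le_iff_le_toReal (ENNReal.mul_ne_top ENNReal.ofReal_ne_top hann),
    ENNReal.toReal_mul, ENNReal.toReal_ofReal (by positivity)] at h
  exact h

lemma angle_nonneg (Ω : Set Plane) (r : ℝ) : 0 ≤ angle Ω r := ENNReal.toReal_nonneg

lemma angle_le (Ω : Set Plane) (r : ℝ) : angle Ω r ≤ 2 * Real.pi := by
  refine ENNReal.toReal_le_of_le_ofReal Real.two_pi_pos.le ?_
  rw [← hausdorffMeasure_sphere]
  exact measure_mono inter_subset_left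

/-! ### Growth of the height. -/

/-- The distance from the real axis of the endpoint of an arc of radius `r` that is centered on
the axis and has the same angular measure as `Ω`. -/
def height (Ω : Set Plane) (r : ℝ) : ℝ := r * Real.sin (angle Ω r / 2)

/-- The length of the frontier of `Ω` in a closed annulus. -/
def annulusLength (Ω : Set Plane) (r₁ r₂ : ℝ) : ℝ := (μH[1] (annulus (frontier Ω) r₁ r₂)).toReal

lemma annulusLength_mono {Ω : Set Plane} (hfin : μH[1] (frontier Ω) < ∞) {r₁ r₂ s t : ℝ}
    (h₁ : r₁ ≤ s) (h₂ : t ≤ r₂) : annulusLength Ω s t ≤ annulusLength Ω r₁ r₂ :=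
  ENNReal.toReal_mono (ne_top_of_le_ne_top hfin.ne (measure_mono inter_subset_left))
    (measure_mono fun _ hx => ⟨hx.1, h₁.trans hx.2.1, hx.2.2.trans h₂⟩)

lemma abs_sin_sub_sin_le (x y : ℝ) : |Real.sin x - Real.sin y| ≤ |x - y| := by
  have := Real.lipschitzWith_sin.dist_le_mul x y
  simpa [Real.dist_eq] using this

/-- Expansion at `x`: the coefficient `|cos x|` becomes the weight `b` of `annulus_estimate`, and
the quadratic term is an error on thin annuli. -/
lemma sin_sub_sin_le (x y : ℝ) :
    Real.sin x - Real.sin y ≤ (x - y) ^ 2 / 2 + |Real.cos x| * |x - y| := by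
  have h1 : Real.sin y = Real.sin x * Real.cos (x - y) - Real.cos x * Real.sin (x - y) := by
    rw [← Real.sin_sub]; congr 1; ring
  have h2 := Real.one_sub_sq_div_two_le_cos (x := x - y)
  have h3 : Real.cos x * Real.sin (x - y) ≤ |Real.cos x| * |x - y| := by
    refine (le_abs_self _).trans ?_
    rw [abs_mul]
    exact mul_le_mul_of_nonneg_left Real.abs_sin_le_abs (abs_nonneg _)
  have h4 : Real.sin x * (1 - Real.cos (x - y)) ≤ 1 - Real.cos (x - y) :=
    mul_le_of_le_one_left (by linarith [Real.cos_le_one (x - y)]) (Real.sin_le_one x)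
  rw [h1]
  linarith

/-- The main case uses `annulus_estimate` with weights `sin x`, `|cos x|`. If `M > δ r₁`, the
thickness is at most `δ M`; if `sin x ≤ δ`, the radial term is at most `δ (r₂ - r₁)`. In both,
angular variation alone suffices. Otherwise the half-angle oscillates by at most `δ < sin x`, so no
circle in the annulus has angle `0` or `2π`. -/
lemma height_increment {r : WithTop ℕ∞} (hr : 1 ≤ r) {Ω : Set Plane} (hΩ : IsOpen Ω)
    (hb : HasPiecewiseSmoothBoundary r Ω) {r₀ r₁ r₂ δ : ℝ} (h₀ : 0 < r₀) (h₀₁ : r₀ ≤ r₁)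
    (h₁₂ : r₁ ≤ r₂) (hδ : 0 < δ) (hgap : r₂ - r₁ ≤ δ ^ 2 * r₀) :
    2 * (height Ω r₂ - height Ω r₁) ≤
      (1 + 6 * δ) * annulusLength Ω r₁ r₂ + 2 * δ * (r₂ - r₁) := by
  have h₁ : 0 < r₁ := h₀.trans_le h₀₁
  set M := annulusLength Ω r₁ r₂ with hM
  have hM0 : 0 ≤ M := ENNReal.toReal_nonneg
  have hang : ∀ ε > 0, r₁ * |angle Ω r₂ - angle Ω r₁| ≤ (1 + 4 * ε) * M := fun ε hε => by
    have := annulus_estimate hr hΩ hb h₁ h₁₂ hε le_rfl zero_le_one (by norm_num) (Or.inl rfl)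
    simpa [hM, annulusLength] using this
  set x := angle Ω r₂ / 2 with hx
  set y := angle Ω r₁ / 2 with hy
  have hxy : |angle Ω r₂ - angle Ω r₁| = 2 * |x - y| := by
    rw [show angle Ω r₂ - angle Ω r₁ = 2 * (x - y) by rw [hx, hy]; ring, abs_mul, abs_two]
  have hx0 : 0 ≤ Real.sin x := Real.sin_nonneg_of_nonneg_of_le_pi
    (by linarith [angle_nonneg Ω r₂]) (by linarith [angle_le Ω r₂])
  have hx1 := Real.sin_le_one x
  have hsplit : height Ω r₂ - height Ω r₁ =
      (r₂ - r₁) * Real.sin x + r₁ * (Real.sin x - Real.sin y) := by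
    rw [height, height, ← hx, ← hy]; ring
  have hlip : 2 * (r₁ * (Real.sin x - Real.sin y)) ≤ (1 + 4 * δ) * M := by
    have h1 := hang δ hδ
    have h2 := (le_abs_self _).trans (abs_sin_sub_sin_le x y)
    rw [hxy] at h1
    nlinarith
  rw [hsplit]
  rcases lt_or_ge (δ * r₁) M with hbad | hgood
  · have h1 : (r₂ - r₁) * Real.sin x ≤ r₂ - r₁ :=
      mul_le_of_le_one_right (by linarith) hx1
    have h2 : δ ^ 2 * r₀ ≤ δ * M := by nlinarith
    nlinarith
  rcases le_or_gt (Real.sin x) δ with hsmall | hlarge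
  · have h1 : (r₂ - r₁) * Real.sin x ≤ (r₂ - r₁) * δ :=
      mul_le_mul_of_nonneg_left hsmall (by linarith)
    nlinarith
  have hosc : ∀ s ∈ Ioo r₁ r₂, |x - angle Ω s / 2| ≤ δ := fun s hs => by
    -- For `ε = 1/4` the factor `1 + 4 ε = 2` cancels the factor between angle and half-angle.
    have h1 := annulus_estimate hr hΩ hb (h₁.trans hs.1) hs.2.le (show (0 : ℝ) < 1 / 4 by norm_num)
      le_rfl zero_le_one (by norm_num) (Or.inl rfl)
    have h2 : annulusLength Ω s r₂ ≤ M := annulusLength_mono hb.1 hs.1.le le_rfl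
    rw [annulusLength] at h2
    have h3 : |angle Ω r₂ - angle Ω s| = 2 * |x - angle Ω s / 2| := by
      rw [show angle Ω r₂ - angle Ω s = 2 * (x - angle Ω s / 2) by rw [hx]; ring, abs_mul, abs_two]
    rw [h3] at h1
    have h4 : r₁ * |x - angle Ω s / 2| ≤ s * |x - angle Ω s / 2| :=
      mul_le_mul_of_nonneg_right hs.1.le (abs_nonneg _)
    have h5 : r₁ * |x - angle Ω s / 2| ≤ r₁ * δ := by linarith
    exact le_of_mul_le_mul_left h5 h₁
  have hZ : ∀ s ∈ Ioo r₁ r₂, 0 < angle Ω s ∧ angle Ω s < 2 * Real.pi := fun s hs => by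
    have h1 := (le_abs_self _).trans (abs_sin_sub_sin_le x (angle Ω s / 2))
    have h2 : 0 < Real.sin (angle Ω s / 2) := by linarith [hosc s hs]
    refine ⟨lt_of_le_of_ne (angle_nonneg Ω s) fun h => ?_, lt_of_le_of_ne (angle_le Ω s) fun h => ?_⟩
    · rw [← h] at h2; simp at h2
    · rw [h] at h2; simp at h2
  have hmain := annulus_estimate hr hΩ hb h₁ h₁₂ hδ hx0 (abs_nonneg (Real.cos x))
    (by rw [sq_abs]; exact Real.sin_sq_add_cos_sq x) (Or.inr hZ)
  rw [hxy] at hmain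
  change _ ≤ (1 + 4 * δ) * M at hmain
  have hs := sin_sub_sin_le x y
  have hquad : r₁ * (x - y) ^ 2 ≤ 2 * δ * M := by
    have h1 := hang (1 / 4) (by norm_num)
    rw [hxy] at h1
    have h2 : r₁ * |x - y| ≤ M := by linarith
    have h3 : |x - y| ≤ δ := le_of_mul_le_mul_left (by linarith) h₁
    rw [← sq_abs]
    nlinarith [abs_nonneg (x - y)]
  nlinarith [mul_le_mul_of_nonneg_left hs h₁.le, mul_nonneg hδ.le (sub_nonneg.2 h₁₂)]

lemma annulusLength_add_le {Ω : Set Plane} (hfin : μH[1] (frontier Ω) < ∞) {r₁ r₂ s : ℝ}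
    (h₁ : r₁ ≤ s) (h₂ : s ≤ r₂) (hs : μH[1] (frontier Ω ∩ {x | ‖x‖ = s}) = 0) :
    annulusLength Ω r₁ s + annulusLength Ω s r₂ ≤ annulusLength Ω r₁ r₂ := by
  have hne : ∀ s t, μH[1] (annulus (frontier Ω) s t) ≠ ∞ := fun s t =>
    ne_top_of_le_ne_top hfin.ne (measure_mono inter_subset_left)
  rw [annulusLength, annulusLength, annulusLength,
    ← ENNReal.toReal_add (hne _ _) (hne _ _)]
  refine ENNReal.toReal_mono (hne _ _) ?_
  have hm := (isClosed_annulus (isClosed_frontier (s := Ω)) s r₂).measurableSet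
  rw [← measure_union_add_inter _ hm]
  have hint : μH[1] (annulus (frontier Ω) r₁ s ∩ annulus (frontier Ω) s r₂) = 0 :=
    measure_mono_null (t := frontier Ω ∩ {x | ‖x‖ = s})
      (fun x hx => ⟨hx.1.1, le_antisymm hx.1.2.2 hx.2.2.1⟩) hs
  rw [hint, add_zero]
  refine measure_mono (union_subset ?_ ?_)
  · exact fun x hx => ⟨hx.1, hx.2.1, hx.2.2.trans h₂⟩
  · exact fun x hx => ⟨hx.1, h₁.trans hx.2.1, hx.2.2⟩

/-- A finite measure charges only countably many of the disjoint circles. -/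
lemma exists_radius_null {Ω : Set Plane} (hfin : μH[1] (frontier Ω) < ∞) {a b : ℝ} (hab : a < b) :
    ∃ s ∈ Ioo a b, μH[1] (frontier Ω ∩ {x | ‖x‖ = s}) = 0 := by
  have : IsFiniteMeasure ((μH[1] : Measure Plane).restrict (frontier Ω)) :=
    ⟨by rwa [Measure.restrict_apply_univ]⟩
  have hc := Measure.countable_meas_level_set_pos (μ := (μH[1] : Measure Plane).restrict (frontier Ω))
    (measurable_norm (α := Plane))
  obtain ⟨s, hs, hsab⟩ := (hc.dense_compl ℝ).exists_between hab
  refine ⟨s, hsab, ?_⟩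
  have hm : MeasurableSet {x : Plane | ‖x‖ = s} := measurable_norm (measurableSet_singleton s)
  have h0 : (μH[1] : Measure Plane).restrict (frontier Ω) {x | ‖x‖ = s} = 0 := by
    by_contra h
    exact hs (pos_iff_ne_zero.2 h)
  rwa [Measure.restrict_apply hm, inter_comm] at h0

/-- Closed annuli overlap in a circle, so cuts are made at radii carrying no frontier length.
Choosing such a radius leaves an outer annulus of thickness between `δ ^ 2 * r₀ / 2` and `δ ^ 2 *
r₀`, hence the half in the step size. -/
lemma height_sub_le {r : WithTop ℕ∞} (hr : 1 ≤ r) {Ω : Set Plane} (hΩ : IsOpen Ω)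
    (hb : HasPiecewiseSmoothBoundary r Ω) {r₀ δ : ℝ} (h₀ : 0 < r₀) (hδ : 0 < δ) (n : ℕ) :
    ∀ r₁ r₂ : ℝ, r₀ ≤ r₁ → r₁ ≤ r₂ → r₂ - r₁ ≤ n * (δ ^ 2 * r₀ / 2) →
    2 * (height Ω r₂ - height Ω r₁) ≤
      (1 + 6 * δ) * annulusLength Ω r₁ r₂ + 2 * δ * (r₂ - r₁) := by
  induction n with
  | zero =>
    intro r₁ r₂ h₀₁ h₁₂ hle
    refine height_increment hr hΩ hb h₀ h₀₁ h₁₂ hδ (hle.trans ?_)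
    simp only [Nat.cast_zero, zero_mul]
    positivity
  | succ n ih =>
    intro r₁ r₂ h₀₁ h₁₂ hle
    rcases le_or_gt (r₂ - r₁) (δ ^ 2 * r₀) with hsmall | hlarge
    · exact height_increment hr hΩ hb h₀ h₀₁ h₁₂ hδ hsmall
    have hη : 0 < δ ^ 2 * r₀ := by positivity
    obtain ⟨s, hs, hs0⟩ := exists_radius_null hb.1
      (show r₂ - δ ^ 2 * r₀ < r₂ - δ ^ 2 * r₀ / 2 by linarith)
    have h1s : r₁ ≤ s := by linarith [hs.1]
    have hs2 : s ≤ r₂ := by linarith [hs.2]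
    push_cast at hle
    have h1 := ih r₁ s h₀₁ h1s (by linarith [hs.2])
    have h2 := height_increment hr hΩ hb h₀ (h₀₁.trans h1s) hs2 hδ (by linarith [hs.1])
    have h3 := annulusLength_add_le hb.1 h1s hs2 hs0
    nlinarith

lemma two_mul_height_le {r : WithTop ℕ∞} (hr : 1 ≤ r) {Ω : Set Plane} (hΩ : IsOpen Ω)
    (hb : HasPiecewiseSmoothBoundary r Ω) {s : ℝ} (hs0 : 0 < s) (hs1 : s < 1) :
    2 * height Ω s ≤ (μH[1] (interiorBoundary (Metric.ball 0 1) Ω)).toReal := by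
  set m := (μH[1] (interiorBoundary (Metric.ball 0 1) Ω)).toReal with hm
  -- `t` serves both as inner radius and as `δ`, so a single limit `t → 0` removes all errors.
  have key : ∀ t ∈ Ioo 0 s, 2 * height Ω s ≤ 2 * t + (1 + 6 * t) * m + 2 * t := by
    rintro t ⟨ht0, hts⟩
    obtain ⟨n, hn⟩ := exists_nat_ge ((s - t) / (t ^ 2 * t / 2))
    rw [div_le_iff₀ (by positivity)] at hn
    have h1 := height_sub_le hr hΩ hb ht0 ht0 n t s le_rfl hts.le hn
    have h2 : annulusLength Ω t s ≤ m := by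
      refine ENNReal.toReal_mono (ne_top_of_le_ne_top hb.1.ne (measure_mono inter_subset_left))
        (measure_mono fun x hx => ⟨hx.1, ?_⟩)
      rw [mem_ball_zero_iff]
      exact hx.2.2.trans_lt hs1
    have h3 : height Ω t ≤ t := mul_le_of_le_one_right ht0.le (Real.sin_le_one _)
    nlinarith
  have hlim : Tendsto (fun t : ℝ => 2 * t + (1 + 6 * t) * m + 2 * t) (𝓝[>] 0) (𝓝 m) := by
    have : Continuous fun t : ℝ => 2 * t + (1 + 6 * t) * m + 2 * t := by fun_prop
    simpa using (this.tendsto 0).mono_left nhdsWithin_le_nhds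
  refine ge_of_tendsto hlim ?_
  filter_upwards [Ioo_mem_nhdsGT hs0] with t ht using key t ht

/-! ### Passage to the unit circle and the lower bound. -/

/-- The angular measures of concentric circles converge to the length of the exterior boundary. -/
lemma tendsto_trace {r : WithTop ℕ∞} (hr : 1 ≤ r) {Ω : Set Plane}
    (hΩ : Ω ∈ domains r (Metric.ball 0 1)) :
    Tendsto (fun s => μH[1] (trace Ω s)) (𝓝[<] 1)
      (𝓝 (μH[1] (exteriorBoundary (Metric.ball 0 1) Ω))) := by
  obtain ⟨hsub, hopen, -, -, F, hF, hreg⟩ := hΩ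
  have hnull := Measure.nullSingletonClass_hausdorff Plane one_pos
  set μ := (μH[1] : Measure Plane).restrict (Metric.sphere 0 1) with hμ
  have : IsFiniteMeasure μ :=
    ⟨by rw [Measure.restrict_apply_univ, hausdorffMeasure_sphere]; exact ENNReal.ofReal_lt_top⟩
  have hmeas : ∀ s : ℝ, MeasurableSet {p : Plane | s • p ∈ Ω} := fun s =>
    (hopen.preimage (continuous_const_smul s)).measurableSet
  -- Regular frontier points are limits along radii in `Ω`; other points of the circle are off the
  -- closure. Dominated convergence on the circle then applies.
  have hae : ∀ᵐ p ∂μ, ∀ᶠ s : ℝ in 𝓝[<] 1, p ∈ {p : Plane | s • p ∈ Ω} ↔ p ∈ frontier Ω := by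
    have h1 : ∀ᵐ p ∂μ, p ∉ F :=
      ae_restrict_of_ae (measure_eq_zero_iff_ae_notMem.1 (hF.measure_zero _))
    have h2 : ∀ᵐ p ∂μ, p ∈ Metric.sphere (0 : Plane) 1 :=
      ae_restrict_mem Metric.isClosed_sphere.measurableSet
    filter_upwards [h1, h2] with p hpF hp
    rw [mem_sphere_zero_iff_norm] at hp
    by_cases hpf : p ∈ frontier Ω
    · obtain ⟨U, hU, hpU, φ, hφ, hd, hz⟩ := hreg p ⟨hpf, hpF⟩
      filter_upwards [radius_mem hopen hsub hpf hp hU hpU (hφ.of_le hr) (hd p hpU) hz] with s hs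
      exact iff_of_true hs hpf
    · have hpc : p ∉ closure Ω := fun h => by
        refine hpf ?_
        rw [hopen.frontier_eq]
        refine ⟨h, fun hpΩ => ?_⟩
        have := hsub hpΩ
        rw [mem_ball_zero_iff, hp] at this
        exact lt_irrefl _ this
      have hc : Tendsto (fun s : ℝ => s • p) (𝓝[<] 1) (𝓝 p) := by
        have : Continuous fun s : ℝ => s • p := by fun_prop
        simpa using (this.tendsto 1).mono_left nhdsWithin_le_nhds
      filter_upwards [hc (isClosed_closure.isOpen_compl.mem_nhds hpc)] with s hs
      exact iff_of_false (fun h => hs (subset_closure h)) hpf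
  have h := tendsto_measure_of_ae_tendsto_indicator_of_isFiniteMeasure (𝓝[<] (1 : ℝ))
    (isClosed_frontier (s := Ω)).measurableSet hmeas hae
  have e1 : ∀ s : ℝ, μ {p : Plane | s • p ∈ Ω} = μH[1] (trace Ω s) := fun s => by
    rw [hμ, Measure.restrict_apply (hmeas s), inter_comm]; rfl
  have e2 : μ (frontier Ω) = μH[1] (exteriorBoundary (Metric.ball 0 1) Ω) := by
    rw [hμ, Measure.restrict_apply isClosed_frontier.measurableSet, exteriorBoundary,
      frontier_ball _ one_ne_zero]
  simpa only [e1, e2] using h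

lemma exteriorBoundary_ne_top (Ω : Set Plane) :
    μH[1] (exteriorBoundary (Metric.ball 0 1) Ω) ≠ ∞ := by
  refine ne_top_of_le_ne_top ?_ (measure_mono inter_subset_right)
  rw [frontier_ball _ one_ne_zero, hausdorffMeasure_sphere]
  exact ENNReal.ofReal_ne_top

/-- The isoperimetric inequality in the disk: the interior boundary is at least as long as the
chord of an arc with the length of the exterior boundary. -/
theorem chord_le_interiorBoundary {r : WithTop ℕ∞} (hr : 1 ≤ r) {Ω : Set Plane}
    (hΩ : Ω ∈ domains r (Metric.ball 0 1)) :
    2 * Real.sin ((μH[1] (exteriorBoundary (Metric.ball 0 1) Ω)).toReal / 2) ≤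
      (μH[1] (interiorBoundary (Metric.ball 0 1) Ω)).toReal := by
  have hang : Tendsto (angle Ω) (𝓝[<] 1)
      (𝓝 (μH[1] (exteriorBoundary (Metric.ball 0 1) Ω)).toReal) :=
    (ENNReal.tendsto_toReal (exteriorBoundary_ne_top Ω)).comp (tendsto_trace hr hΩ)
  have hid : Tendsto (fun s : ℝ => s) (𝓝[<] 1) (𝓝 1) := tendsto_id.mono_left nhdsWithin_le_nhds
  have hlim := (hid.mul ((Real.continuous_sin.tendsto _).comp (hang.div_const 2))).const_mul 2
  rw [one_mul] at hlim
  refine le_of_tendsto hlim ?_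
  filter_upwards [Ioo_mem_nhdsLT (zero_lt_one (α := ℝ))] with s hs
  exact two_mul_height_le hr hΩ.2.1 hΩ.2.2.2 hs.1 hs.2

/-- The exterior boundaries of disjoint domains do not overlap. -/
lemma sum_exteriorBoundary_le {r : WithTop ℕ∞} (hr : 1 ≤ r) {k : ℕ} {Ω : Fin k → Set Plane}
    (hΩ : Ω ∈ tuples r (Metric.ball 0 1) k) :
    ∑ j, μH[1] (exteriorBoundary (Metric.ball 0 1) (Ω j)) ≤ ENNReal.ofReal (2 * Real.pi) := by
  -- Exterior boundaries may share points, but the traces at each radius are disjoint; the bound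
  -- passes to the limit.
  refine le_of_tendsto' (tendsto_finsetSum _ fun j _ => tendsto_trace hr (hΩ.1 j)) fun s => ?_
  have hm : ∀ j, MeasurableSet (trace (Ω j) s) := fun j =>
    Metric.isClosed_sphere.measurableSet.inter
      ((hΩ.1 j).2.1.preimage (continuous_const_smul s)).measurableSet
  rw [← hausdorffMeasure_sphere, ← tsum_fintype (L := .unconditional _), ← measure_iUnion ?_ hm]
  · exact measure_mono (iUnion_subset fun j => inter_subset_left)
  · exact fun i j hij => Set.disjoint_left.2 fun p hi hj =>
      Set.disjoint_left.1 (hΩ.2 hij) hi.2 hj.2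

/-- Concavity of sine on `[0, π]`, with `x` a convex combination of `0` and `y`. -/
lemma sin_div_antitone {x y : ℝ} (hx : 0 < x) (hxy : x ≤ y) (hy : y ≤ Real.pi) :
    Real.sin y / y ≤ Real.sin x / x := by
  have hy0 : 0 < y := hx.trans_le hxy
  have h := strictConcaveOn_sin_Icc.concaveOn.2 (left_mem_Icc.2 Real.pi_pos.le) ⟨hy0.le, hy⟩
    (show 0 ≤ 1 - x / y by rw [sub_nonneg, div_le_one hy0]; exact hxy)
    (show 0 ≤ x / y by positivity) (by ring)
  simp only [smul_eq_mul, mul_zero, Real.sin_zero, zero_add, div_mul_cancel₀ _ hy0.ne'] at h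
  rw [le_div_iff₀ hx]
  calc _ = x / y * Real.sin y := by ring
    _ ≤ _ := h

theorem le_escobarConstant_disk {r : WithTop ℕ∞} (hr : 1 ≤ r) {k : ℕ} (hk : 1 ≤ k) :
    ENNReal.ofReal (Real.sin (Real.pi / k) / (Real.pi / k)) ≤
      escobarConstant r (Metric.ball 0 1) k := by
  have hk' : (1 : ℝ) ≤ k := by exact_mod_cast hk
  have hπ : Real.pi / k ≤ Real.pi := div_le_self Real.pi_pos.le hk'
  refine le_iInf₂ fun Ω hΩ => ?_
  -- Pigeonhole: at least one domain takes no more than its `k`-th share of the circle.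
  obtain ⟨j, hj⟩ : ∃ j, μH[1] (exteriorBoundary (Metric.ball 0 1) (Ω j)) ≤
      ENNReal.ofReal (2 * (Real.pi / k)) := by
    by_contra! h
    have hne : (Finset.univ : Finset (Fin k)).Nonempty := ⟨⟨0, hk⟩, Finset.mem_univ _⟩
    have h1 := (ENNReal.sum_lt_sum_of_nonempty hne fun j _ => h j).trans_le
      (sum_exteriorBoundary_le hr hΩ)
    rw [Finset.sum_const, Finset.card_univ, Fintype.card_fin, nsmul_eq_mul,
      ← ENNReal.ofReal_natCast, ← ENNReal.ofReal_mul (by positivity)] at h1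
    refine h1.ne ?_
    congr 1
    field_simp
  refine le_trans ?_ (le_iSup _ j)
  rw [ratio]
  split_ifs with h0
  · exact le_top
  have hE := exteriorBoundary_ne_top (Ω j)
  set E := μH[1] (exteriorBoundary (Metric.ball 0 1) (Ω j)) with hEdef
  have hEpos : 0 < E.toReal := ENNReal.toReal_pos h0 hE
  have hEle : E.toReal ≤ 2 * (Real.pi / k) := ENNReal.toReal_le_of_le_ofReal (by positivity) hj
  have hI := chord_le_interiorBoundary hr (hΩ.1 j)
  rw [← hEdef] at hI
  have hIne : μH[1] (interiorBoundary (Metric.ball 0 1) (Ω j)) ≠ ∞ :=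
    ne_top_of_le_ne_top (hΩ.1 j).2.2.2.1.ne (measure_mono inter_subset_left)
  have hs := sin_div_antitone (half_pos hEpos) (by linarith) hπ
  rw [← ENNReal.ofReal_toReal hIne, ← ENNReal.ofReal_toReal hE,
    ← ENNReal.ofReal_div_of_pos hEpos]
  refine ENNReal.ofReal_le_ofReal (hs.trans ?_)
  rw [div_div_eq_mul_div, mul_comm]
  gcongr

end Escobar

end

theorem theorem1p2 (r : WithTop ℕ∞) (hr : 1 ≤ r) (k : ℕ) (hk : 1 ≤ k) :
    Escobar.escobarConstant r (Metric.ball (0 : Escobar.Plane) 1) k =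
      ENNReal.ofReal (Real.sin (Real.pi / (k : ℝ)) / (Real.pi / (k : ℝ))) :=
  le_antisymm (Escobar.escobarConstant_disk_le r hk) (Escobar.le_escobarConstant_disk hr hk)
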